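/- Let $a<b$, let $\alpha\in W^{1,\infty}((a,b);\mathbb R)$ (identified with its continuous representative on $[a,b]$) and $\beta\in L^\infty((a,b);\mathbb C)$, and suppose that $2\operatorname{Re}\beta+\alpha'\ge 2\mu_0$ a.e. on $(a,b)$ for some $\mu_0>0$. On $\mathcal H=L^2((a,b);\mathbb C)$ consider the operators with domain $C_c^\infty(a,b)$ $$T\varphi=(\alpha\varphi)'+\beta\varphi,\qquad \widetilde T\varphi=-(\alpha\varphi)'+(\overline\beta+\alpha')\varphi ,$$ and put $T_0=\overline T$, $\widetilde T_0=\overline{\widetilde T}$, $T_1=\widetilde T^*$, $\widetilde T_1=T^*$, $\mathcal W_0=\operatorname{dom}T_0=\operatorname{dom}\widetilde T_0$, $\mathcal W=\operatorname{dom}T_1=\operatorname{dom}\widetilde T_1$. A realisation of $T$ (of $\widetilde T$) is a restriction $T_1|_{\mathcal V}$ ($\widetilde T_1|_{\mathcal V}$) to a subspace $\mathcal W_0\subseteq\mathcal V\subseteq\mathcal W$; it is called bijective if it is a bijection $\mathcal V\to\mathcal H$. A pair $(\mathcal V,\widetilde{\mathcal V})$ is called admissible if $T_1|_{\mathcal V}$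 and $\widetilde T_1|_{\widetilde{\mathcal V}}$ are bijective realisations that are adjoint to each other. **1.** Suppose $\alpha(a)\alpha(b)\le 0$. Then there is exactly one admissible pair. It is $(\mathcal W_0,\mathcal W)$ if $\alpha(a)\ge 0\ge\alpha(b)$, and $(\mathcal W,\mathcal W_0)$ if $\alpha(a)\le 0\le\alpha(b)$. Moreover, $T_1|_{\mathcal W_0}$ (respectively $T_1$) is the only bijective realisation of $T$. The dimensions $(\dim\ker T_1,\dim\ker\widetilde T_1)$ are - $(0,0)$ if $\alpha(a)=\alpha(b)=0$; - $(1,0)$ if $\alpha(a)>0=\alpha(b)$ or $\alpha(a)=0>\alpha(b)$; - $(0,1)$ if $\alpha(a)<0=\alpha(b)$ or $\alpha(a)=0<\alpha(b)$; - $(2,0)$ if $\alpha(a)>0>\alpha(b)$; - $(0,2)$ if $\alpha(a)<0<\alpha(b)$. **2.** Suppose $\alpha(a)\alpha(b)>0$. Then $\dim\ker T_1=\dim\ker\widetilde T_1=1$; every $u\in\mathcal W$ has well-defined values $u(a)$, $u(b)$ (the values at $a$ and $b$ of its continuous representative near these points); and there are infinitely many admissible pairs. Put $s=\sqrt{\alpha(a)/\alpha(b)}$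 and let $\varphi$ and $\tilde\varphi$ be any non-zero elements of $\ker T_1$ and $\ker\widetilde T_1$. Then $\Delta:=\varphi(b)-s\varphi(a)\ne0$ and $\widetilde\Delta:=\tilde\varphi(b)-s\tilde\varphi(a)\ne0$. The admissible pairs are exactly the reference pair $(\mathcal V_{\rm r},\mathcal V_{\rm r})$ with $\mathcal V_{\rm r}=\{u\in\mathcal W: u(b)=s\,u(a)\}$, and the pairs $(\operatorname{dom}T_{c,d},\operatorname{dom}T_{c,d}^*)$, $(c,d)\in\mathbb R^2\setminus\{(0,0)\}$, where $\operatorname{dom}T_{c,d}$ is the set of all $u\in\mathcal W$ with $$\Bigl(\frac{\alpha(b)\overline{\tilde\varphi(b)}}{\|\tilde\varphi\|^2}-\frac{c+id}{\Delta}\Bigr)u(b)=\Bigl(\frac{\alpha(a)\overline{\tilde\varphi(a)}}{\|\tilde\varphi\|^2}-\frac{(c+id)s}{\Delta}\Bigr)u(a)$$ and $\operatorname{dom}T_{c,d}^*$ is the set of all $u\in\mathcal W$ with $$\Bigl(\alpha(b)\overline{\varphi(b)}+\frac{\|\tilde\varphi\|^2(c-id)}{\widetilde\Delta}\Bigr)u(b)=\Bigl(\alpha(a)\overline{\varphi(a)}+\frac{\|\tilde\varphi\|^2(c-id)s}{\widetilde\Delta}\Bigr)u(a).$$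 The bijective realisations of $T$ are exactly the restrictions of $T_1$ to $\mathcal V_{\rm r}$ and to the spaces $\operatorname{dom}T_{c,d}$, $(c,d)\ne(0,0)$, and these domains are pairwise different. -/

import Mathlib

open MeasureTheory Set Filter Topology
open scoped ContDiff ENNReal LinearPMap

namespace Friedrichs

/-! ### Realisations of a pair of densely defined operators -/

section Abstract

variable {H : Type*} [NormedAddCommGroup H] [InnerProductSpace ℂ H] [CompleteSpace H]

/-- The kernel of a partially defined operator, as a subspace of `H`. -/
def kernel (A : H →ₗ.[ℂ] H) : Submodule ℂ H :=
  (LinearMap.ker A.toFun).map A.domain.subtype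

/-- `dom (closure T) ⊆ V ⊆ dom (Tt†)`, where `Tt†` is the Hilbert space adjoint of `Tt`. The
realisation of `T` with domain `V` is then `Tt†.domRestrict V`, the restriction of the maximal
operator `T₁ = Tt†` to `V`. -/
def IsBetween (T Tt : H →ₗ.[ℂ] H) (V : Submodule ℂ H) : Prop :=
  T.closure.domain ≤ V ∧ V ≤ Tt†.domain

/-- `V` is the domain of a bijective realisation of `T` relative to the pair `(T, Tt)`. -/
def IsBijectiveRealisation (T Tt : H →ₗ.[ℂ] H) (V : Submodule ℂ H) : Prop :=
  IsBetween T Tt V ∧ Function.Bijective (Tt†.domRestrict V)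

/-- The restrictions of `T₁ = Tt†` to `V` and of `T†` to `Vt` form a pair of mutually adjoint
bijective realisations relative to `(T, Tt)`. -/
def IsAdjointBijectivePair (T Tt : H →ₗ.[ℂ] H) (V Vt : Submodule ℂ H) : Prop :=
  IsBijectiveRealisation T Tt V ∧ IsBijectiveRealisation Tt T Vt ∧
    (Tt†.domRestrict V)† = T†.domRestrict Vt ∧ (T†.domRestrict Vt)† = Tt†.domRestrict V

end Abstract

/-! ### Weak derivatives on an interval -/

/-- Smooth complex functions with compact support contained in `(a, b)`. -/
structure IsTest (a b : ℝ) (φ : ℝ → ℂ) : Prop where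
  contDiff : ContDiff ℝ ∞ φ
  hasCompactSupport : HasCompactSupport φ
  tsupport_subset : tsupport φ ⊆ Ioo a b

/-- `g` is the weak (distributional) derivative of `f` on `(a, b)`. -/
structure IsWeakDeriv (a b : ℝ) (f g : ℝ → ℂ) : Prop where
  left : LocallyIntegrableOn f (Ioo a b) volume
  right : LocallyIntegrableOn g (Ioo a b) volume
  integral_eq : ∀ ψ : ℝ → ℂ, IsTest a b ψ →
    ∫ x in Ioo a b, f x * deriv ψ x = - ∫ x in Ioo a b, g x * ψ x

/-- `α` is the continuous representative on `[a, b]` of a real function in `W^{1,∞}(a, b)`, with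
weak derivative `α'`. -/
structure IsW1Infty (a b : ℝ) (α α' : ℝ → ℝ) : Prop where
  continuousOn : ContinuousOn α (Icc a b)
  memLp : MemLp α ∞ (volume.restrict (Ioo a b))
  memLp_deriv : MemLp α' ∞ (volume.restrict (Ioo a b))
  isWeakDeriv : IsWeakDeriv a b (fun x => (α x : ℂ)) (fun x => (α' x : ℂ))

theorem IsTest.add {a b : ℝ} {φ ψ : ℝ → ℂ} (hφ : IsTest a b φ) (hψ : IsTest a b ψ) :
    IsTest a b (φ + ψ) where
  contDiff := hφ.contDiff.add hψ.contDiff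
  hasCompactSupport := hφ.hasCompactSupport.add hψ.hasCompactSupport
  tsupport_subset := (tsupport_add φ ψ).trans (union_subset hφ.tsupport_subset hψ.tsupport_subset)

theorem IsTest.smul {a b : ℝ} {φ : ℝ → ℂ} (c : ℂ) (hφ : IsTest a b φ) :
    IsTest a b (c • φ) where
  contDiff := hφ.contDiff.const_smul c
  hasCompactSupport := hφ.hasCompactSupport.mono (Function.support_const_smul_subset c φ)
  tsupport_subset :=
    (closure_mono (Function.support_const_smul_subset c φ)).trans hφ.tsupport_subset

theorem IsTest.zero (a b : ℝ) : IsTest a b 0 where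
  contDiff := contDiff_const
  hasCompactSupport := HasCompactSupport.zero
  tsupport_subset := by simp [tsupport]

theorem IsTest.deriv {a b : ℝ} {φ : ℝ → ℂ} (hφ : IsTest a b φ) : IsTest a b (deriv φ) where
  contDiff := (contDiff_infty_iff_deriv.1 hφ.contDiff).2
  hasCompactSupport := hφ.hasCompactSupport.deriv
  tsupport_subset := (closure_minimal support_deriv_subset (isClosed_tsupport φ)).trans
    hφ.tsupport_subset

theorem integrableOn_mul_test {a b : ℝ} {f φ : ℝ → ℂ}
    (hf : LocallyIntegrableOn f (Ioo a b) volume) (hφ : IsTest a b φ) :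
    IntegrableOn (fun x => f x * φ x) (Ioo a b) volume := by
  have h1 : IntegrableOn (fun x => f x * φ x) (tsupport φ) volume :=
    (hf.integrableOn_compact_subset hφ.tsupport_subset hφ.hasCompactSupport).mul_continuousOn
      hφ.contDiff.continuous.continuousOn hφ.hasCompactSupport
  have h2 : Integrable (fun x => f x * φ x) volume := by
    rw [← integrableOn_iff_integrable_of_support_subset (s := tsupport φ)]
    · exact h1
    · intro x hx
      exact subset_tsupport _ (right_ne_zero_of_mul hx)
  exact h2.integrableOn

theorem IsWeakDeriv.add {a b : ℝ} {f g f' g' : ℝ → ℂ} (h : IsWeakDeriv a b f f')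
    (k : IsWeakDeriv a b g g') : IsWeakDeriv a b (f + g) (f' + g') where
  left := h.left.add k.left
  right := h.right.add k.right
  integral_eq ψ hψ := by
    simp only [Pi.add_apply, add_mul]
    rw [integral_add (integrableOn_mul_test h.left hψ.deriv)
      (integrableOn_mul_test k.left hψ.deriv),
      integral_add (integrableOn_mul_test h.right hψ) (integrableOn_mul_test k.right hψ),
      h.integral_eq ψ hψ, k.integral_eq ψ hψ, neg_add]

theorem IsWeakDeriv.smul {a b : ℝ} {f f' : ℝ → ℂ} (c : ℂ) (h : IsWeakDeriv a b f f') :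
    IsWeakDeriv a b (c • f) (c • f') where
  left := h.left.smul c
  right := h.right.smul c
  integral_eq ψ hψ := by
    simp only [Pi.smul_apply, smul_eq_mul, mul_assoc, integral_const_mul]
    rw [h.integral_eq ψ hψ, mul_neg]

theorem IsWeakDeriv.zero (a b : ℝ) : IsWeakDeriv a b 0 0 where
  left := locallyIntegrableOn_zero
  right := locallyIntegrableOn_zero
  integral_eq ψ hψ := by simp

/-! ### The one-dimensional scalar operators -/

/-- The Hilbert space `L²((a, b); ℂ)`. -/
abbrev L2 (a b : ℝ) : Type := Lp ℂ 2 (volume.restrict (Ioo a b))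

/-- The graph of the operator `φ ↦ (p φ)' + q φ`, `φ ∈ C_c^∞(a, b)`, in `L²(a, b)`. -/
def opGraph (a b : ℝ) (p q : ℝ → ℂ) : Submodule ℂ (L2 a b × L2 a b) where
  carrier := {w | ∃ φ g : ℝ → ℂ, IsTest a b φ ∧ IsWeakDeriv a b (p * φ) g ∧
    w.1 =ᵐ[volume.restrict (Ioo a b)] φ ∧ w.2 =ᵐ[volume.restrict (Ioo a b)] g + q * φ}
  zero_mem' := ⟨0, 0, IsTest.zero a b, by simpa using IsWeakDeriv.zero a b,
    Lp.coeFn_zero ℂ 2 (volume.restrict (Ioo a b)), by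
    simpa using Lp.coeFn_zero ℂ 2 (volume.restrict (Ioo a b))⟩
  add_mem' := by
    rintro ⟨u, h⟩ ⟨v, k⟩ ⟨φ, g, hφ, hg, hu, hh⟩ ⟨ψ, l, hψ, hl, hv, hk⟩
    refine ⟨φ + ψ, g + l, hφ.add hψ, by simpa [mul_add] using hg.add hl, ?_, ?_⟩
    · exact (Lp.coeFn_add u v).trans (hu.add hv)
    · refine ((Lp.coeFn_add h k).trans (hh.add hk)).trans (Eventually.of_forall fun x => ?_)
      simp only [Pi.add_apply, Pi.mul_apply]
      ring
  smul_mem' := by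
    rintro c ⟨u, h⟩ ⟨φ, g, hφ, hg, hu, hh⟩
    refine ⟨c • φ, c • g, hφ.smul c, by simpa using hg.smul c, ?_, ?_⟩
    · exact (Lp.coeFn_smul c u).trans (hu.const_smul c)
    · refine ((Lp.coeFn_smul c h).trans (hh.const_smul c)).trans (Eventually.of_forall fun x => ?_)
      simp only [Pi.add_apply, Pi.mul_apply, Pi.smul_apply, smul_eq_mul]
      ring

/-- The graph above is single-valued. -/
theorem opGraph_functional (a b : ℝ) (p q : ℝ → ℂ) (w : L2 a b × L2 a b)
    (hw : w ∈ opGraph a b p q) (h0 : w.1 = 0) : w.2 = 0 := by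
  obtain ⟨φ, g, hφ, hg, hu, hh⟩ := hw
  have hφ0 : φ =ᵐ[volume.restrict (Ioo a b)] 0 :=
    hu.symm.trans (by rw [h0]; exact Lp.coeFn_zero _ _ _)
  have hg0 : ∀ᵐ x ∂volume, x ∈ Ioo a b → g x = 0 := by
    refine isOpen_Ioo.ae_eq_zero_of_integral_contDiff_smul_eq_zero hg.right ?_
    intro ψ h1 h2 h3
    have hψ : IsTest a b (fun x => (ψ x : ℂ)) := by
      refine ⟨Complex.ofRealCLM.contDiff.comp h1, h2.comp_left (g := Complex.ofReal) rfl, ?_⟩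
      refine (closure_mono ?_).trans h3
      intro x hx
      simpa using hx
    have e := hg.integral_eq _ hψ
    have e1 : ∫ x in Ioo a b, (p * φ) x * deriv (fun x => (ψ x : ℂ)) x = 0 := by
      refine integral_eq_zero_of_ae ?_
      filter_upwards [hφ0] with x hx
      simp [hx]
    rw [e1, eq_comm, neg_eq_zero] at e
    rw [← setIntegral_eq_integral_of_forall_compl_eq_zero (s := Ioo a b), ← e]
    · refine integral_congr_ae (Eventually.of_forall fun x => ?_)
      simp [mul_comm]
    · intro x hx
      have : ψ x = 0 := by
        by_contra hne
        exact hx (h3 (subset_tsupport _ hne))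
      simp [this]
  have hg1 : g =ᵐ[volume.restrict (Ioo a b)] 0 :=
    (ae_restrict_iff' measurableSet_Ioo).2 hg0
  refine Lp.ext (hh.trans (EventuallyEq.trans ?_ (Lp.coeFn_zero _ _ _).symm))
  filter_upwards [hg1, hφ0] with x hx hx'
  simp [hx, hx']

/-- The operator `φ ↦ (p φ)' + q φ` in `L²(a, b)` with domain `C_c^∞(a, b)`. -/
noncomputable def op (a b : ℝ) (p q : ℝ → ℂ) : L2 a b →ₗ.[ℂ] L2 a b :=
  (opGraph a b p q).toLinearPMap

/-- `T φ = (α φ)' + β φ` on `C_c^∞(a, b)`. -/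
noncomputable def opT (a b : ℝ) (α : ℝ → ℝ) (β : ℝ → ℂ) : L2 a b →ₗ.[ℂ] L2 a b :=
  op a b (fun x => (α x : ℂ)) β

/-- `T̃ φ = -(α φ)' + (conj β + α') φ` on `C_c^∞(a, b)`. -/
noncomputable def opTt (a b : ℝ) (α α' : ℝ → ℝ) (β : ℝ → ℂ) : L2 a b →ₗ.[ℂ] L2 a b :=
  op a b (fun x => -(α x : ℂ)) (fun x => starRingEnd ℂ (β x) + (α' x : ℂ))

/-! ### Endpoint values -/

/-- Near the point `x` of `[a, b]` the function `u` agrees almost everywhere with a function that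
is continuous (up to the boundary) and has the value `z` at `x`. -/
def HasValueAt (a b : ℝ) (u : ℝ → ℂ) (x : ℝ) (z : ℂ) : Prop :=
  ∃ f : ℝ → ℂ, ∃ U ∈ 𝓝 x, ContinuousOn f (U ∩ Icc a b) ∧
    (∀ᵐ t ∂volume.restrict (Ioo a b), t ∈ U → u t = f t) ∧ f x = z

open scoped Classical in
/-- The value at `x` of the continuous representative of `u` near `x` (and `0` if `u` has no
representative that is continuous near `x`). -/
noncomputable def valueAt (a b : ℝ) (u : ℝ → ℂ) (x : ℝ) : ℂ :=
  if h : ∃ z, HasValueAt a b u x z then h.choose else 0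

theorem HasValueAt.add {a b : ℝ} {u v : ℝ → ℂ} {x : ℝ} {z w : ℂ} (hu : HasValueAt a b u x z)
    (hv : HasValueAt a b v x w) : HasValueAt a b (u + v) x (z + w) := by
  obtain ⟨f, U, hU, hf, huf, hz⟩ := hu
  obtain ⟨g, V, hV, hg, hvg, hw⟩ := hv
  refine ⟨f + g, U ∩ V, inter_mem hU hV, ?_, ?_, by simp [hz, hw]⟩
  · exact (hf.mono fun t ht => ⟨ht.1.1, ht.2⟩).add (hg.mono fun t ht => ⟨ht.1.2, ht.2⟩)
  · filter_upwards [huf, hvg] with t h1 h2 ht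
    simp [h1 ht.1, h2 ht.2]

theorem HasValueAt.smul {a b : ℝ} {u : ℝ → ℂ} {x : ℝ} {z : ℂ} (c : ℂ)
    (hu : HasValueAt a b u x z) : HasValueAt a b (c • u) x (c * z) := by
  obtain ⟨f, U, hU, hf, huf, hz⟩ := hu
  refine ⟨c • f, U, hU, hf.const_smul c, ?_, by simp [hz]⟩
  filter_upwards [huf] with t h1 ht
  simp [h1 ht]

theorem HasValueAt.zero (a b x : ℝ) : HasValueAt a b 0 x 0 :=
  ⟨0, univ, univ_mem, continuousOn_const, Eventually.of_forall fun _ _ => rfl, rfl⟩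

theorem HasValueAt.congr {a b : ℝ} {u v : ℝ → ℂ} {x : ℝ} {z : ℂ}
    (h : u =ᵐ[volume.restrict (Ioo a b)] v) (hu : HasValueAt a b u x z) :
    HasValueAt a b v x z := by
  obtain ⟨f, U, hU, hf, huf, hz⟩ := hu
  refine ⟨f, U, hU, hf, ?_, hz⟩
  filter_upwards [huf, h] with t h1 h2 ht
  rw [← h2, h1 ht]

/-- The subspace `{u ∈ W : γ u(b) = δ u(a)}`. -/
def boundarySpace (a b : ℝ) (W : Submodule ℂ (L2 a b)) (γ δ : ℂ) : Submodule ℂ (L2 a b) where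
  carrier := {u | u ∈ W ∧ ∃ za zb : ℂ, HasValueAt a b u a za ∧ HasValueAt a b u b zb ∧
    γ * zb = δ * za}
  zero_mem' := ⟨W.zero_mem, 0, 0,
    (HasValueAt.zero a b a).congr (Lp.coeFn_zero _ _ _).symm,
    (HasValueAt.zero a b b).congr (Lp.coeFn_zero _ _ _).symm, by simp⟩
  add_mem' := by
    rintro u v ⟨hu, za, zb, h1, h2, h3⟩ ⟨hv, wa, wb, k1, k2, k3⟩
    refine ⟨W.add_mem hu hv, za + wa, zb + wb, (h1.add k1).congr (Lp.coeFn_add u v).symm,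
      (h2.add k2).congr (Lp.coeFn_add u v).symm, ?_⟩
    rw [mul_add, mul_add, h3, k3]
  smul_mem' := by
    rintro c u ⟨hu, za, zb, h1, h2, h3⟩
    refine ⟨W.smul_mem c hu, c * za, c * zb, (h1.smul c).congr (Lp.coeFn_smul c u).symm,
      (h2.smul c).congr (Lp.coeFn_smul c u).symm, ?_⟩
    rw [mul_left_comm, h3, mul_left_comm]

/-! ### The boundary conditions when `α(a) α(b) > 0` -/

/-- `√(α(a)/α(b))`. -/
noncomputable def ratio (a b : ℝ) (α : ℝ → ℝ) : ℂ := (Real.sqrt (α a / α b) : ℂ)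

/-- `u(b) - √(α(a)/α(b)) u(a)`. -/
noncomputable def jump (a b : ℝ) (α : ℝ → ℝ) (u : ℝ → ℂ) : ℂ :=
  valueAt a b u b - ratio a b α * valueAt a b u a

/-- The reference domain `{u ∈ W : u(b) = √(α(a)/α(b)) u(a)}`. -/
noncomputable def domRef (a b : ℝ) (α : ℝ → ℝ) (W : Submodule ℂ (L2 a b)) :
    Submodule ℂ (L2 a b) :=
  boundarySpace a b W 1 (ratio a b α)

/-- The domain, with `k = c + id`, of all `u ∈ W` such that
`(α(b) conj φ̃(b) / ‖φ̃‖² - k / Δ) u(b) = (α(a) conj φ̃(a) / ‖φ̃‖² - k √(α(a)/α(b)) / Δ) u(a)`,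
where `Δ = φ(b) - √(α(a)/α(b)) φ(a)`. -/
noncomputable def domT (a b : ℝ) (α : ℝ → ℝ) (W : Submodule ℂ (L2 a b)) (φ φt : L2 a b) (k : ℂ) :
    Submodule ℂ (L2 a b) :=
  boundarySpace a b W
    ((α b : ℂ) * starRingEnd ℂ (valueAt a b φt b) / (‖φt‖ : ℂ) ^ 2 - k / jump a b α φ)
    ((α a : ℂ) * starRingEnd ℂ (valueAt a b φt a) / (‖φt‖ : ℂ) ^ 2
      - k * ratio a b α / jump a b α φ)

/-- The domain, with `k = c + id`, of all `u ∈ W` such that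
`(α(b) conj φ(b) + ‖φ̃‖² conj k / Δ̃) u(b) = (α(a) conj φ(a) + ‖φ̃‖² conj k √(α(a)/α(b)) / Δ̃) u(a)`,
where `Δ̃ = φ̃(b) - √(α(a)/α(b)) φ̃(a)`. -/
noncomputable def domTadj (a b : ℝ) (α : ℝ → ℝ) (W : Submodule ℂ (L2 a b)) (φ φt : L2 a b)
    (k : ℂ) : Submodule ℂ (L2 a b) :=
  boundarySpace a b W
    ((α b : ℂ) * starRingEnd ℂ (valueAt a b φ b)
      + (‖φt‖ : ℂ) ^ 2 * starRingEnd ℂ k / jump a b α φt)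
    ((α a : ℂ) * starRingEnd ℂ (valueAt a b φ a)
      + (‖φt‖ : ℂ) ^ 2 * starRingEnd ℂ k * ratio a b α / jump a b α φt)

end Friedrichs

/-! Everything is governed by the boundary form `bform L Lt u v = ⟨v, T₁ u⟩ - ⟨T̃₁ v, u⟩` on the
common maximal domain `W`. The minimal domain `W₀` is its radical (`mem_closure_domain`), and the
adjoint of the realisation on `V` is the realisation of the other operator on the orthogonal
complement of `V` for this form (`mem_adjoint_graph_iff`). Since `T₁ + T̃₁` is multiplication by `2
Re β + α' ≥ 2 μ₀`, the sum is coercive. If `V` and `Vt` are mutually orthogonal for the form, with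
the form nonnegative on `V` and nonpositive on `Vt`, then `T₁` on `V` and `T̃₁` on `Vt` are bounded
below, each range is closed and dense, and both realisations are bijective
(`bijective_of_orthogonal`).

The analytic input is Green's formula (`integral_green`): the form equals `α(b) u(b) conj v(b) -
α(a) u(a) conj v(a)`, a term being absent where `α` vanishes. Only `α u`, not `u`, is absolutely
continuous, and `α` may vanish on any closed set, so `1/α` is regularised to `α/(α² + ε)`. The
dominated limit works because the derivatives of `α`, `α u` and `α v` vanish almost everywhere on
the zero set of `α`. Affine functions realise all endpoint values. `exists_boundarySystem` packages
this; what remains is linear algebra in a trace space of dimension at most two.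

If `α(a) α(b) ≤ 0` the form is semidefinite, so `(W₀, W)` or `(W, W₀)` is admissible. Two nested
bijective realisations coincide, and every realisation lies between `W₀` and `W`, whence uniqueness.
The kernel of a maximal operator is isomorphic to `W/V` for any bijective realisation on `V`
(`rank_kernel`), which gives the dimensions by counting the nonzero coefficients.

If `α(a) α(b) > 0` the form is indefinite, and the isotropic line `u(b) = s u(a)` is its own
orthogonal complement, giving the reference pair. Then `W = V_r ⊕ ℂφ`, and the bijective
realisations are given exactly by the boundary lines that do not contain the traces of `φ`. By
Green, the kernel element `φ̃` supplies the functional `u ↦ ⟨φ̃, T₁ u⟩`, which together with `u ↦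
u(b) - s u(a)` is a basis of the boundary functionals. With `k = c + id`, the domain of `T_{c,d}` is
the condition `⟨φ̃, T₁ u⟩ / ‖φ̃‖² = k (u(b) - s u(a)) / Δ`: the `φ̃`-coefficient of `T₁ u` is `k`
times the `φ`-coefficient of `u`. -/

namespace Friedrichs

/-! ### Pairs of operators with explicitly known maximal operators -/

section Abstract

variable {H : Type*} [NormedAddCommGroup H] [InnerProductSpace ℂ H]

/-- `T` and `Tt` are densely defined and formally adjoint to each other, and their maximal
operators `Tt†` and `T†` are given by the linear maps `L` and `Lt` on the same space `W`. -/
structure MaximalPair [CompleteSpace H] (T Tt : H →ₗ.[ℂ] H) (W : Submodule ℂ H) (L Lt : W →ₗ[ℂ] H) : Prop where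
  dense : Dense (T.domain : Set H)
  dense' : Dense (Tt.domain : Set H)
  formal : T.IsFormalAdjoint Tt
  adj' : Tt† = ⟨W, L⟩
  adj : T† = ⟨W, Lt⟩

/-- The boundary form `⟨v, L u⟩ - ⟨Lt v, u⟩`. -/
noncomputable def bform {W : Submodule ℂ H} (L Lt : W →ₗ[ℂ] H) (u v : W) : ℂ :=
  inner ℂ (v : H) (L u) - inner ℂ (Lt v) (u : H)

theorem bform_swap {W : Submodule ℂ H} (L Lt : W →ₗ[ℂ] H) (u v : W) :
    bform Lt L u v = - starRingEnd ℂ (bform L Lt v u) := by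
  simp [bform, inner_conj_symm]

theorem bform_swap_eq_zero {W : Submodule ℂ H} {L Lt : W →ₗ[ℂ] H} {u v : W} :
    bform Lt L u v = 0 ↔ bform L Lt v u = 0 := by
  simp [bform_swap L Lt u v]

namespace MaximalPair

variable [CompleteSpace H] {T Tt : H →ₗ.[ℂ] H} {W : Submodule ℂ H} {L Lt : W →ₗ[ℂ] H}

theorem swap (h : MaximalPair T Tt W L Lt) : MaximalPair Tt T W Lt L :=
  ⟨h.dense', h.dense, h.formal.symm, h.adj, h.adj'⟩

theorem le_maximal (h : MaximalPair T Tt W L Lt) : T ≤ ⟨W, L⟩ :=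
  h.adj' ▸ h.formal.symm.le_adjoint h.dense'

theorem apply_eq (h : MaximalPair T Tt W L Lt) (x : T.domain) :
    L ⟨x, h.le_maximal.1 x.2⟩ = T x :=
  (h.le_maximal.2 (x := x) (y := ⟨x, h.le_maximal.1 x.2⟩) rfl).symm

/-- The defining property of the maximal operator. -/
theorem mem_of_forall (h : MaximalPair T Tt W L Lt) {x y : H}
    (hxy : ∀ v : Tt.domain, inner ℂ (v : H) y = inner ℂ (Tt v) x) :
    ∃ hx : x ∈ W, L ⟨x, hx⟩ = y := by
  have hxy' : ∀ v : Tt.domain, inner ℂ y (v : H) = inner ℂ x (Tt v) := fun v => by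
    rw [← inner_conj_symm, hxy, inner_conj_symm]
  have hx : x ∈ Tt†.domain := LinearPMap.mem_adjoint_domain_of_exists x ⟨y, hxy'⟩
  have hy : Tt† ⟨x, hx⟩ = y := LinearPMap.adjoint_apply_eq h.dense' ⟨x, hx⟩ hxy'
  have hg : (x, y) ∈ (Tt†).graph := hy ▸ LinearPMap.mem_graph _ ⟨x, hx⟩
  rw [h.adj'] at hg
  obtain ⟨z, hz1, hz2⟩ := (LinearPMap.mem_graph_iff _).1 hg
  obtain rfl : (z : H) = x := hz1
  exact ⟨z.2, hz2⟩

theorem bform_of_mem_domain (h : MaximalPair T Tt W L Lt) (x : T.domain) (v : W) :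
    bform L Lt ⟨x, h.le_maximal.1 x.2⟩ v = 0 := by
  have := LinearPMap.adjoint_isFormalAdjoint h.dense
  rw [h.adj] at this
  simp only [bform, h.apply_eq x, sub_eq_zero]
  exact (this v x).symm

theorem isClosable (h : MaximalPair T Tt W L Lt) : T.IsClosable := by
  have := LinearPMap.adjoint_isClosed h.dense'
  rw [h.adj'] at this
  exact this.isClosable.leIsClosable h.le_maximal

/-- The minimal domain is the radical of the boundary form. -/
theorem mem_closure_domain (h : MaximalPair T Tt W L Lt) {x : H} :
    x ∈ T.closure.domain ↔ ∃ hx : x ∈ W, ∀ v, bform L Lt ⟨x, hx⟩ v = 0 := by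
  rw [LinearPMap.mem_domain_iff]
  simp_rw [← h.isClosable.graph_closure_eq_closure_graph]
  constructor
  · rintro ⟨y, hy⟩
    have hv : ∀ v : W, inner ℂ (v : H) y = inner ℂ (Lt v) x := by
      intro v
      have hc : IsClosed {p : H × H | inner ℂ (v : H) p.2 = inner ℂ (Lt v) p.1} :=
        isClosed_eq (by fun_prop) (by fun_prop)
      refine closure_minimal (s := (T.graph : Set (H × H))) ?_ hc hy
      rintro ⟨p, q⟩ hpq
      obtain ⟨z, rfl, rfl⟩ := (LinearPMap.mem_graph_iff _).1 hpq
      have := h.bform_of_mem_domain z v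
      rwa [bform, sub_eq_zero, h.apply_eq] at this
    obtain ⟨hx, hLx⟩ := h.mem_of_forall (x := x) (y := y) fun v => by
      rw [← h.swap.apply_eq v, hv ⟨v, _⟩]
    exact ⟨hx, fun v => by rw [bform, hLx, hv, sub_self]⟩
  · rintro ⟨hx, hv⟩
    refine ⟨L ⟨x, hx⟩, ?_⟩
    -- The closure of the graph is its double orthogonal complement in the Hilbert sum `H ⊕ H`. A
    -- vector orthogonal to the graph of `T` has the form `(-Lt q, q)` with `q ∈ W`, so
    -- orthogonality of `(x, L x)` to it is precisely `bform L Lt x q = 0`.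
    let K : Submodule ℂ (WithLp 2 (H × H)) :=
      T.graph.comap (WithLp.linearEquiv 2 ℂ (H × H)).toLinearMap
    have hK : WithLp.toLp 2 (x, L ⟨x, hx⟩) ∈ Kᗮᗮ := by
      rw [Submodule.mem_orthogonal]
      intro w hw
      rw [Submodule.mem_orthogonal] at hw
      obtain ⟨hq, hLq⟩ := h.swap.mem_of_forall (x := w.snd) (y := - w.fst) fun z => by
        have := hw (WithLp.toLp 2 ((z : H), T z)) (LinearPMap.mem_graph T z)
        rw [WithLp.prod_inner_apply] at this
        simp only at this
        rw [inner_neg_right, ← add_eq_zero_iff_neg_eq]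
        exact this
      have h1 := hv ⟨w.snd, hq⟩
      rw [bform, hLq, inner_neg_left, sub_neg_eq_add, add_comm] at h1
      rw [WithLp.prod_inner_apply]
      exact h1
    rw [Submodule.orthogonal_orthogonal_eq_closure] at hK
    exact map_mem_closure (f := WithLp.ofLp) (t := (T.graph : Set (H × H)))
      (WithLp.prod_continuous_ofLp 2 H H) hK fun w hw => hw

theorem closure_domain_le (h : MaximalPair T Tt W L Lt) : T.closure.domain ≤ W := fun _ hx =>
  (h.mem_closure_domain.1 hx).1

theorem domain_le_closure (_h : MaximalPair T Tt W L Lt) : T.domain ≤ T.closure.domain :=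
  (LinearPMap.le_closure T).1

/-- Both minimal operators have the same domain. -/
theorem closure_domain_swap (h : MaximalPair T Tt W L Lt)
    (hsymm : ∀ u v, bform L Lt u v = 0 ↔ bform L Lt v u = 0) :
    Tt.closure.domain = T.closure.domain := by
  ext x
  rw [h.mem_closure_domain, h.swap.mem_closure_domain]
  exact exists_congr fun hx => forall_congr' fun v => bform_swap_eq_zero.trans (hsymm _ _)

theorem domRestrict_apply (h : MaximalPair T Tt W L Lt) {V : Submodule ℂ H}
    (x : (Tt†.domRestrict V).domain) (hx : (x : H) ∈ W) : Tt†.domRestrict V x = L ⟨x, hx⟩ := by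
  have h1 : (Tt†.domRestrict V) ≤ ⟨W, L⟩ := h.adj' ▸ LinearPMap.domRestrict_le
  exact h1.2 (x := x) (y := ⟨x, hx⟩) rfl

theorem mem_domRestrict_domain (h : MaximalPair T Tt W L Lt) {V : Submodule ℂ H} {x : H} :
    x ∈ (Tt†.domRestrict V).domain ↔ x ∈ V ∧ x ∈ W := by
  rw [LinearPMap.domRestrict_domain, Submodule.mem_inf, h.adj']

theorem isBetween_iff (h : MaximalPair T Tt W L Lt) {V : Submodule ℂ H} :
    IsBetween T Tt V ↔ T.closure.domain ≤ V ∧ V ≤ W := by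
  rw [IsBetween, h.adj']

theorem bijective_domRestrict_iff (h : MaximalPair T Tt W L Lt) {V : Submodule ℂ H} :
    Function.Bijective (Tt†.domRestrict V) ↔
      (∀ u : W, (u : H) ∈ V → L u = 0 → u = 0) ∧ ∀ f, ∃ u : W, (u : H) ∈ V ∧ L u = f := by
  have hW : ∀ x : (Tt†.domRestrict V).domain, (x : H) ∈ W := fun x =>
    (h.mem_domRestrict_domain.1 x.2).2
  refine and_congr ⟨fun hi u hu h0 => ?_, fun hi => ?_⟩ ⟨fun hs f => ?_, fun hs f => ?_⟩
  · have e : Tt†.domRestrict V ⟨u, h.mem_domRestrict_domain.2 ⟨hu, u.2⟩⟩ =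
        Tt†.domRestrict V 0 := by
      rw [h.domRestrict_apply _ u.2, LinearPMap.map_zero]
      exact h0
    have := congrArg Subtype.val (hi e)
    exact Subtype.ext this
  · intro x y hxy
    rw [h.domRestrict_apply x (hW x), h.domRestrict_apply y (hW y), ← sub_eq_zero,
      ← map_sub] at hxy
    have := hi _ (V.sub_mem (h.mem_domRestrict_domain.1 x.2).1 (h.mem_domRestrict_domain.1 y.2).1)
      hxy
    exact Subtype.ext (sub_eq_zero.1 (congrArg Subtype.val this))
  · obtain ⟨x, hx⟩ := hs f
    exact ⟨⟨x, hW x⟩, (h.mem_domRestrict_domain.1 x.2).1, by rw [← hx, h.domRestrict_apply x (hW x)]⟩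
  · obtain ⟨u, hu, hf⟩ := hs f
    exact ⟨⟨u, h.mem_domRestrict_domain.2 ⟨hu, u.2⟩⟩, by rw [h.domRestrict_apply _ u.2, ← hf]⟩

/-- The adjoint of a realisation is given by the orthogonal complement of its domain with respect
to the boundary form. -/
theorem mem_adjoint_graph_iff (h : MaximalPair T Tt W L Lt) {V : Submodule ℂ H}
    (hV : IsBetween T Tt V) {y z : H} :
    (y, z) ∈ ((Tt†.domRestrict V)†).graph ↔
      ∃ hy : y ∈ W, Lt ⟨y, hy⟩ = z ∧ ∀ u : W, (u : H) ∈ V → bform L Lt u ⟨y, hy⟩ = 0 := by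
  rw [h.isBetween_iff] at hV
  have hdom : ∀ x ∈ T.domain, x ∈ (Tt†.domRestrict V).domain := fun x hx =>
    h.mem_domRestrict_domain.2 ⟨hV.1 (h.domain_le_closure hx), h.le_maximal.1 hx⟩
  have hd : Dense ((Tt†.domRestrict V).domain : Set H) := h.dense.mono hdom
  rw [LinearPMap.adjoint_graph_eq_graph_adjoint hd, Submodule.mem_adjoint_iff]
  constructor
  · intro hyz
    have key : ∀ u : W, (u : H) ∈ V → inner ℂ (L u) y = inner ℂ (u : H) z := by
      intro u hu
      refine sub_eq_zero.1 (hyz u (L u) ?_)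
      refine (LinearPMap.mem_graph_iff _).2
        ⟨⟨u, h.mem_domRestrict_domain.2 ⟨hu, u.2⟩⟩, rfl, h.domRestrict_apply _ u.2⟩
    obtain ⟨hy, hLy⟩ := h.swap.mem_of_forall (x := y) (y := z) fun v => by
      rw [← h.apply_eq v, key ⟨v, _⟩ (hV.1 (h.domain_le_closure v.2))]
    refine ⟨hy, hLy, fun u hu => ?_⟩
    rw [bform, hLy, ← inner_conj_symm, key u hu, inner_conj_symm, sub_self]
  · rintro ⟨hy, rfl, hu⟩ p q hpq
    obtain ⟨x, rfl, rfl⟩ := (LinearPMap.mem_graph_iff _).1 hpq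
    have hx := h.mem_domRestrict_domain.1 x.2
    have := hu ⟨x, hx.2⟩ hx.1
    rw [bform, sub_eq_zero, ← inner_conj_symm, ← inner_conj_symm (Lt _)] at this
    rw [h.domRestrict_apply x hx.2, sub_eq_zero]
    exact (starRingEnd ℂ).injective this

theorem adjoint_domRestrict_eq_iff (h : MaximalPair T Tt W L Lt) {V : Submodule ℂ H}
    (hV : IsBetween T Tt V) {Vt : Submodule ℂ H} :
    (Tt†.domRestrict V)† = T†.domRestrict Vt ↔
      ∀ v : W, (v : H) ∈ Vt ↔ ∀ u : W, (u : H) ∈ V → bform L Lt u v = 0 := by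
  have hg : ∀ y z, (y, z) ∈ (T†.domRestrict Vt).graph ↔
      ∃ hy : y ∈ W, Lt ⟨y, hy⟩ = z ∧ y ∈ Vt := by
    intro y z
    rw [LinearPMap.mem_graph_iff]
    constructor
    · rintro ⟨x, rfl, rfl⟩
      have hx := h.swap.mem_domRestrict_domain.1 x.2
      exact ⟨hx.2, (h.swap.domRestrict_apply x hx.2).symm, hx.1⟩
    · rintro ⟨hy, rfl, hy'⟩
      exact ⟨⟨y, h.swap.mem_domRestrict_domain.2 ⟨hy', hy⟩⟩, rfl, h.swap.domRestrict_apply _ hy⟩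
  constructor
  · intro e v
    have := h.mem_adjoint_graph_iff hV (y := v) (z := Lt v)
    rw [e, hg] at this
    constructor
    · intro hv
      obtain ⟨_, _, h3⟩ := this.1 ⟨v.2, rfl, hv⟩
      exact h3
    · intro hv
      obtain ⟨_, _, h3⟩ := this.2 ⟨v.2, rfl, hv⟩
      exact h3
  · intro e
    refine LinearPMap.eq_of_eq_graph ?_
    ext ⟨y, z⟩
    rw [h.mem_adjoint_graph_iff hV, hg]
    exact exists_congr fun hy => and_congr_right fun _ => (e ⟨y, hy⟩).symm

/-- A pair of spaces which are mutually orthogonal with respect to the boundary form, on which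
that form has the right signs, gives a pair of mutually adjoint bijective realisations. -/
theorem bijective_of_orthogonal (h : MaximalPair T Tt W L Lt) {μ : ℝ} (hμ : 0 < μ)
    (hc : ∀ u : W, 2 * μ * ‖(u : H)‖ ^ 2 ≤ (inner ℂ (u : H) (L u + Lt u)).re)
    {V Vt : Submodule ℂ H} (hV : IsBetween T Tt V) (hVt : Tt.closure.domain ≤ Vt)
    (h1 : ∀ v : W, (v : H) ∈ Vt ↔ ∀ u : W, (u : H) ∈ V → bform L Lt u v = 0)
    (h2 : ∀ u : W, (u : H) ∈ V ↔ ∀ v : W, (v : H) ∈ Vt → bform L Lt u v = 0)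
    (h3 : ∀ u : W, (u : H) ∈ V → 0 ≤ (bform L Lt u u).re)
    (h4 : ∀ v : W, (v : H) ∈ Vt → (bform L Lt v v).re ≤ 0) :
    Function.Bijective (Tt†.domRestrict V) := by
  have hre : ∀ u : W, (bform L Lt u u).re =
      (inner ℂ (u : H) (L u)).re - (inner ℂ (u : H) (Lt u)).re := fun u => by
    rw [bform, Complex.sub_re, ← inner_conj_symm (Lt u) (u : H), Complex.conj_re]
  have hcu : ∀ u : W, (u : H) ∈ V → μ * ‖(u : H)‖ ≤ ‖L u‖ := by
    intro u hu
    -- Coercivity bounds `Re ⟨u, L u⟩ + Re ⟨u, Lt u⟩` from below, and the sign of the form bounds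
    -- the difference of the two terms; halving gives `Re ⟨u, L u⟩ ≥ μ ‖u‖²`.
    have a1 := hc u
    have a2 := h3 u hu
    rw [hre] at a2
    rw [inner_add_right, Complex.add_re] at a1
    have a3 : (inner ℂ (u : H) (L u)).re ≤ ‖(u : H)‖ * ‖L u‖ := re_inner_le_norm (𝕜 := ℂ) _ _
    rcases eq_or_lt_of_le (norm_nonneg (u : H)) with h0 | h0
    · rw [← h0, mul_zero]
      exact norm_nonneg _
    · nlinarith
  have hinj : ∀ v : W, (v : H) ∈ Vt → Lt v = 0 → v = 0 := by
    intro v hv h0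
    have a1 := hc v
    have a2 := h4 v hv
    rw [hre] at a2
    rw [inner_add_right, Complex.add_re] at a1
    rw [h0, inner_zero_right, Complex.zero_re] at a1 a2
    have a3 : ‖(v : H)‖ ^ 2 ≤ 0 := by nlinarith
    have a4 : ‖(v : H)‖ = 0 := by nlinarith [norm_nonneg (v : H)]
    exact Subtype.ext (norm_eq_zero.1 a4)
  rw [h.bijective_domRestrict_iff]
  refine ⟨fun u hu h0 => ?_, ?_⟩
  · have := hcu u hu
    rw [h0, norm_zero] at this
    have a4 : ‖(u : H)‖ = 0 := by nlinarith [norm_nonneg (u : H)]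
    exact Subtype.ext (norm_eq_zero.1 a4)
  let R : Submodule ℂ H := (V.comap W.subtype).map L
  have hRmem : ∀ f, f ∈ R ↔ ∃ u : W, (u : H) ∈ V ∧ L u = f := fun f => by
    simp [R]
  have hRo : Rᗮ = ⊥ := by
    rw [Submodule.eq_bot_iff]
    intro y hy
    rw [Submodule.mem_orthogonal] at hy
    -- Orthogonality to `L` on `dom T` alone already gives `Lt y = 0`; orthogonality to the rest of
    -- `L V` then puts `y` in `Vt`, where `Lt` is injective.
    obtain ⟨hyW, hLy⟩ := h.swap.mem_of_forall (x := y) (y := 0) fun v => by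
      rw [inner_zero_right, ← h.apply_eq v]
      exact (hy _ ((hRmem _).2 ⟨_, (h.isBetween_iff.1 hV).1 (h.domain_le_closure v.2), rfl⟩)).symm
    have hyV : (y : H) ∈ Vt := (h1 ⟨y, hyW⟩).2 fun u hu => by
      rw [bform, hLy, inner_zero_left, sub_zero, ← inner_conj_symm,
        hy _ ((hRmem _).2 ⟨u, hu, rfl⟩), map_zero]
    exact congrArg Subtype.val (hinj ⟨y, hyW⟩ hyV hLy)
  have hRc : IsClosed (R : Set H) := by
    refine isClosed_of_closure_subset fun f hf => ?_
    obtain ⟨s, hs, hsf⟩ := mem_closure_iff_seq_limit.1 hf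
    choose u huV hus using fun n => (hRmem _).1 (hs n)
    have hcs : CauchySeq fun n => ((u n : W) : H) := by
      have hs' := hsf.cauchySeq
      rw [Metric.cauchySeq_iff'] at hs' ⊢
      intro ε hε
      obtain ⟨N, hN⟩ := hs' (μ * ε) (by positivity)
      refine ⟨N, fun n hn => ?_⟩
      have b1 := hN n hn
      have b2 := hcu (u n - u N) (V.sub_mem (huV n) (huV N))
      rw [map_sub, hus, hus, AddSubgroupClass.coe_sub] at b2
      rw [dist_eq_norm] at b1 ⊢
      exact lt_of_mul_lt_mul_left (b2.trans_lt b1) hμ.le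
    obtain ⟨x, hx⟩ := cauchySeq_tendsto_of_complete hcs
    -- The limit identity is needed on all of `Vt`: its part on `dom Tt` yields `L x = f`, and the
    -- whole of it yields `x ∈ V`, the orthogonal complement of `Vt`.
    have hlim : ∀ v : W, (v : H) ∈ Vt → inner ℂ (v : H) f = inner ℂ (Lt v) x := by
      intro v hv
      refine tendsto_nhds_unique (tendsto_const_nhds.inner (𝕜 := ℂ) hsf) ?_
      refine ((tendsto_const_nhds (x := Lt v)).inner (𝕜 := ℂ) hx).congr fun n => ?_
      have := (h2 (u n)).1 (huV n) v hv
      rw [bform, sub_eq_zero, hus] at this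
      exact this.symm
    obtain ⟨hxW, hLx⟩ := h.mem_of_forall (x := x) (y := f) fun v => by
      rw [← h.swap.apply_eq v]
      exact hlim ⟨v, _⟩ (hVt (h.swap.domain_le_closure v.2))
    refine (hRmem f).2 ⟨⟨x, hxW⟩, (h2 ⟨x, hxW⟩).2 fun v hv => ?_, hLx⟩
    rw [bform, hLx, hlim v hv, sub_self]
  intro f
  refine (hRmem f).1 ?_
  have : R.topologicalClosure = ⊤ := Submodule.topologicalClosure_eq_top_iff.2 hRo
  rw [hRc.submodule_topologicalClosure_eq] at this
  rw [this]
  trivial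

/-- The kernel of the maximal operator is isomorphic to the quotient by the domain of a bijective
realisation. -/
theorem rank_kernel (h : MaximalPair T Tt W L Lt) {V : Submodule ℂ H}
    (hb : Function.Bijective (Tt†.domRestrict V)) {E : Type} [AddCommGroup E] [Module ℂ E]
    (Γ : W →ₗ[ℂ] E) (hΓ : Function.Surjective Γ) (hV : ∀ u : W, Γ u = 0 → (u : H) ∈ V)
    (hV' : ∀ u : W, (u : H) ∈ V → Γ u = 0) :
    Module.rank ℂ (kernel Tt†) = Cardinal.lift (Module.rank ℂ E) := by
  rw [h.bijective_domRestrict_iff] at hb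
  have hk : kernel Tt† = (LinearMap.ker L).map W.subtype := by rw [kernel, h.adj']
  have e1 : Module.rank ℂ (kernel Tt†) = Module.rank ℂ (LinearMap.ker L) := by
    rw [hk]
    exact (LinearEquiv.rank_eq
      (Submodule.equivMapOfInjective W.subtype W.injective_subtype (LinearMap.ker L))).symm
  -- `Γ` serves as the quotient map by `V`. It is injective on `ker L` because `ker L` meets `V`
  -- trivially, and surjective because any `u` becomes a kernel element after subtracting the `w ∈
  -- V` with `L w = L u`.
  have hbij : Function.Bijective (Γ.comp (LinearMap.ker L).subtype) := by
    constructor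
    · rw [← LinearMap.ker_eq_bot, Submodule.eq_bot_iff]
      rintro ⟨u, hu⟩ hu'
      exact Subtype.ext (hb.1 u (hV u hu') hu)
    · intro e
      obtain ⟨u, rfl⟩ := hΓ e
      obtain ⟨w, hw, hwu⟩ := hb.2 (L u)
      refine ⟨⟨u - w, ?_⟩, ?_⟩
      · rw [LinearMap.mem_ker, map_sub, hwu, sub_self]
      · simp [hV' w hw]
  rw [e1, ← Cardinal.lift_id'.{0, _} (Module.rank ℂ (LinearMap.ker L))]
  simpa using LinearEquiv.lift_rank_eq (LinearEquiv.ofBijective _ hbij)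

end MaximalPair

end Abstract

/-! ### Realisations when the boundary form is diagonal in two scalar traces. -/

section Boundary

variable {H : Type*} [NormedAddCommGroup H] [InnerProductSpace ℂ H] [CompleteSpace H]
  {T Tt : H →ₗ.[ℂ] H} {W : Submodule ℂ H} {L Lt : W →ₗ[ℂ] H}

namespace MaximalPair

theorem isAdjointBijectivePair_of_orthogonal (h : MaximalPair T Tt W L Lt) {μ : ℝ} (hμ : 0 < μ)
    (hc : ∀ u : W, 2 * μ * ‖(u : H)‖ ^ 2 ≤ (inner ℂ (u : H) (L u + Lt u)).re)
    {V Vt : Submodule ℂ H} (hV : IsBetween T Tt V) (hVt : IsBetween Tt T Vt)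
    (h1 : ∀ v : W, (v : H) ∈ Vt ↔ ∀ u : W, (u : H) ∈ V → bform L Lt u v = 0)
    (h2 : ∀ u : W, (u : H) ∈ V ↔ ∀ v : W, (v : H) ∈ Vt → bform L Lt u v = 0)
    (h3 : ∀ u : W, (u : H) ∈ V → 0 ≤ (bform L Lt u u).re)
    (h4 : ∀ v : W, (v : H) ∈ Vt → (bform L Lt v v).re ≤ 0) :
    IsAdjointBijectivePair T Tt V Vt := by
  have h1' : ∀ v : W, (v : H) ∈ V ↔ ∀ u : W, (u : H) ∈ Vt → bform Lt L u v = 0 := fun v => by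
    simp_rw [bform_swap_eq_zero]
    exact h2 v
  have h2' : ∀ u : W, (u : H) ∈ Vt ↔ ∀ v : W, (v : H) ∈ V → bform Lt L u v = 0 := fun v => by
    simp_rw [bform_swap_eq_zero]
    exact h1 v
  refine ⟨⟨hV, h.bijective_of_orthogonal hμ hc hV hVt.1 h1 h2 h3 h4⟩,
    ⟨hVt, h.swap.bijective_of_orthogonal hμ (fun u => ?_) hVt hV.1 h1' h2' (fun u hu => ?_)
      fun v hv => ?_⟩, (h.adjoint_domRestrict_eq_iff hV).2 h1,
      (h.swap.adjoint_domRestrict_eq_iff hVt).2 h1'⟩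
  · rw [add_comm]
    exact hc u
  · simpa [bform_swap L Lt] using h4 u hu
  · simpa [bform_swap L Lt] using h3 v hv

/-- Surjectivity on the smaller domain and injectivity on the larger one force equality. This is the
source of all uniqueness statements in the semidefinite case. -/
theorem eq_of_le_of_bijective (h : MaximalPair T Tt W L Lt) {V V' : Submodule ℂ H}
    (hV : IsBijectiveRealisation T Tt V) (hV' : IsBijectiveRealisation T Tt V') (hle : V ≤ V') :
    V = V' := by
  refine le_antisymm hle fun x hx => ?_
  have hxW := (h.isBetween_iff.1 hV'.1).2 hx
  obtain ⟨u, hu, hLu⟩ := (h.bijective_domRestrict_iff.1 hV.2).2 (L ⟨x, hxW⟩)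
  have := (h.bijective_domRestrict_iff.1 hV'.2).1 (u - ⟨x, hxW⟩) (V'.sub_mem (hle hu) hx)
    (by rw [map_sub, hLu, sub_self])
  rw [sub_eq_zero] at this
  rw [this] at hu
  exact hu

/-- Both second components are the orthogonal complement of `V` for the boundary form. -/
theorem eq_of_isAdjointBijectivePair (h : MaximalPair T Tt W L Lt) {V Vt Vt' : Submodule ℂ H}
    (hV : IsAdjointBijectivePair T Tt V Vt) (hV' : IsAdjointBijectivePair T Tt V Vt') :
    Vt = Vt' := by
  have e1 := (h.adjoint_domRestrict_eq_iff hV.1.1).1 hV.2.2.1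
  have e2 := (h.adjoint_domRestrict_eq_iff hV.1.1).1 hV'.2.2.1
  have l1 := (h.swap.isBetween_iff.1 hV.2.1.1).2
  have l2 := (h.swap.isBetween_iff.1 hV'.2.1.1).2
  ext x
  exact ⟨fun hx => (e2 ⟨x, l1 hx⟩).2 ((e1 ⟨x, l1 hx⟩).1 hx),
    fun hx => (e1 ⟨x, l2 hx⟩).2 ((e2 ⟨x, l2 hx⟩).1 hx)⟩

theorem mem_kernel (h : MaximalPair T Tt W L Lt) {x : H} :
    x ∈ kernel Tt† ↔ ∃ u : W, (u : H) = x ∧ L u = 0 := by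
  rw [kernel, h.adj']
  simp only [Submodule.mem_map, LinearMap.mem_ker, Submodule.subtype_apply]
  exact exists_congr fun u => and_comm

end MaximalPair

theorem isAdjointBijectivePair_comm {V Vt : Submodule ℂ H} :
    IsAdjointBijectivePair T Tt V Vt ↔ IsAdjointBijectivePair Tt T Vt V := by
  unfold IsAdjointBijectivePair
  tauto

/-- A maximal pair with a coercive sum whose boundary form is diagonal in terms of two boundary
functionals `va`, `vb`, with coefficients `-pa` and `pb`. -/
structure BoundarySystem (T Tt : H →ₗ.[ℂ] H) (W : Submodule ℂ H) (L Lt : W →ₗ[ℂ] H)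
    (μ pa pb : ℝ) (va vb : W →ₗ[ℂ] ℂ) : Prop extends MaximalPair T Tt W L Lt where
  pos : 0 < μ
  coercive : ∀ u : W, 2 * μ * ‖(u : H)‖ ^ 2 ≤ (inner ℂ (u : H) (L u + Lt u)).re
  green : ∀ u v, bform L Lt u v =
    pb * vb u * starRingEnd ℂ (vb v) - pa * va u * starRingEnd ℂ (va v)
  surj : ∀ za zb : ℂ, ∃ u, (pa ≠ 0 → va u = za) ∧ (pb ≠ 0 → vb u = zb)

/-- The space of all `u` with `γ vb(u) = δ va(u)`. -/
def lineSpace (va vb : W →ₗ[ℂ] ℂ) (γ δ : ℂ) : Submodule ℂ H :=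
  (LinearMap.ker (γ • vb - δ • va)).map W.subtype

omit [CompleteSpace H] in
theorem mem_lineSpace {va vb : W →ₗ[ℂ] ℂ} {γ δ : ℂ} {x : H} :
    x ∈ lineSpace va vb γ δ ↔ ∃ hx : x ∈ W, γ * vb ⟨x, hx⟩ = δ * va ⟨x, hx⟩ := by
  simp only [lineSpace, Submodule.mem_map, LinearMap.mem_ker, Submodule.subtype_apply,
    LinearMap.sub_apply, LinearMap.smul_apply, smul_eq_mul, sub_eq_zero]
  constructor
  · rintro ⟨y, h, rfl⟩
    exact ⟨y.2, h⟩
  · rintro ⟨hx, h⟩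
    exact ⟨⟨x, hx⟩, h, rfl⟩

omit [CompleteSpace H] in
theorem coe_mem_lineSpace {va vb : W →ₗ[ℂ] ℂ} {γ δ : ℂ} {u : W} :
    (u : H) ∈ lineSpace va vb γ δ ↔ γ * vb u = δ * va u := by
  rw [mem_lineSpace]
  exact ⟨fun ⟨_, h⟩ => h, fun h => ⟨u.2, h⟩⟩

omit [CompleteSpace H] in
theorem lineSpace_le (va vb : W →ₗ[ℂ] ℂ) (γ δ : ℂ) : lineSpace va vb γ δ ≤ W := fun _ hx =>
  (mem_lineSpace.1 hx).1

omit [CompleteSpace H] in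
theorem lineSpace_smul (va vb : W →ₗ[ℂ] ℂ) (γ δ : ℂ) {c : ℂ} (hc : c ≠ 0) :
    lineSpace va vb (c * γ) (c * δ) = lineSpace va vb γ δ := by
  ext x
  simp_rw [mem_lineSpace, mul_assoc, mul_right_inj' hc]

namespace BoundarySystem

variable {μ pa pb : ℝ} {va vb : W →ₗ[ℂ] ℂ}

/-- Exchanging the operators negates both coefficients, so every result about one maximal operator
transfers to the other with reversed signs. -/
theorem swap (h : BoundarySystem T Tt W L Lt μ pa pb va vb) :
    BoundarySystem Tt T W Lt L μ (-pa) (-pb) va vb where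
  toMaximalPair := h.toMaximalPair.swap
  pos := h.pos
  coercive u := by
    rw [add_comm]
    exact h.coercive u
  green u v := by
    rw [bform_swap L Lt, h.green]
    simp only [map_sub, map_mul, Complex.conj_ofReal, Complex.conj_conj, Complex.ofReal_neg]
    ring
  surj za zb := by simpa using h.surj za zb

/-- The coefficients `pa`, `pb` are real, so the boundary form is Hermitian and its left and right
radicals agree. -/
theorem closure_domain_swap (h : BoundarySystem T Tt W L Lt μ pa pb va vb) :
    Tt.closure.domain = T.closure.domain := by
  refine h.toMaximalPair.closure_domain_swap fun u v => ?_
  have : bform L Lt u v = starRingEnd ℂ (bform L Lt v u) := by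
    rw [h.green, h.green]
    simp only [map_sub, map_mul, Complex.conj_ofReal, Complex.conj_conj]
    ring
  rw [this, map_eq_zero]

/-- The radical is found by testing with elements having one prescribed trace and the other zero; a
trace with zero coefficient does not enter the form and is left free. -/
theorem mem_closure_domain_iff (h : BoundarySystem T Tt W L Lt μ pa pb va vb) {u : W} :
    (u : H) ∈ T.closure.domain ↔ (pa ≠ 0 → va u = 0) ∧ (pb ≠ 0 → vb u = 0) := by
  rw [h.mem_closure_domain]
  constructor
  · rintro ⟨_, hu⟩
    have hu' : ∀ v, bform L Lt u v = 0 := hu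
    refine ⟨fun ha => ?_, fun hb => ?_⟩
    · obtain ⟨v, hva, hvb⟩ := h.surj (va u) 0
      have hb0 : (pb : ℂ) * vb u * starRingEnd ℂ (vb v) = 0 := by
        by_cases hb : pb = 0
        · simp [hb]
        · simp [hvb hb]
      have := hu' v
      rw [h.green, hb0, hva ha] at this
      simpa [ha] using this
    · obtain ⟨v, hva, hvb⟩ := h.surj 0 (vb u)
      have ha0 : (pa : ℂ) * va u * starRingEnd ℂ (va v) = 0 := by
        by_cases ha : pa = 0
        · simp [ha]
        · simp [hva ha]
      have := hu' v
      rw [h.green, ha0, hvb hb] at this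
      simpa [hb] using this
  · rintro ⟨ha, hb⟩
    refine ⟨u.2, fun v => ?_⟩
    change bform L Lt u v = 0
    rw [h.green]
    by_cases ha0 : pa = 0 <;> by_cases hb0 : pb = 0 <;> simp [ha0, hb0, ha, hb]

theorem re_bform_self (h : BoundarySystem T Tt W L Lt μ pa pb va vb) (u : W) :
    (bform L Lt u u).re = pb * ‖vb u‖ ^ 2 - pa * ‖va u‖ ^ 2 := by
  rw [h.green, mul_assoc, mul_assoc, Complex.mul_conj, Complex.mul_conj, Complex.normSq_eq_norm_sq,
    Complex.normSq_eq_norm_sq]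
  norm_cast

/-! #### Semidefinite boundary form -/

/-- The form vanishes on its radical and is nonpositive on all of `W`, and these two spaces are
mutually orthogonal complements, so the abstract criterion applies. -/
theorem isAdjointBijectivePair_minimal (h : BoundarySystem T Tt W L Lt μ pa pb va vb)
    (ha : 0 ≤ pa) (hb : pb ≤ 0) : IsAdjointBijectivePair T Tt T.closure.domain W := by
  have hmem : ∀ u : W, (u : H) ∈ T.closure.domain ↔ ∀ v, bform L Lt u v = 0 := fun u => by
    rw [h.mem_closure_domain]
    exact ⟨fun ⟨_, h'⟩ => h', fun h' => ⟨u.2, h'⟩⟩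
  refine h.isAdjointBijectivePair_of_orthogonal h.pos h.coercive
    (h.isBetween_iff.2 ⟨le_rfl, h.closure_domain_le⟩)
    (h.toMaximalPair.swap.isBetween_iff.2 ⟨h.closure_domain_swap ▸ h.closure_domain_le, le_rfl⟩)
    (fun v => ⟨fun _ u hu => (hmem u).1 hu v, fun _ => v.2⟩)
    (fun u => (hmem u).trans ⟨fun hu v _ => hu v, fun hu v => hu v v.2⟩)
    (fun u hu => by rw [(hmem u).1 hu u, Complex.zero_re]) fun v _ => ?_
  rw [h.re_bform_self]
  nlinarith [sq_nonneg ‖vb v‖, sq_nonneg ‖va v‖]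

theorem characterisation_minimal (h : BoundarySystem T Tt W L Lt μ pa pb va vb)
    (ha : 0 ≤ pa) (hb : pb ≤ 0) :
    (∀ V Vt, IsAdjointBijectivePair T Tt V Vt ↔ V = T.closure.domain ∧ Vt = W) ∧
      ∀ V, IsBijectiveRealisation T Tt V ↔ V = T.closure.domain := by
  have hp := h.isAdjointBijectivePair_minimal ha hb
  have key : ∀ V, IsBijectiveRealisation T Tt V ↔ V = T.closure.domain := fun V =>
    ⟨fun hV => (h.eq_of_le_of_bijective hp.1 hV hV.1.1).symm, fun e => e ▸ hp.1⟩
  refine ⟨fun V Vt => ⟨fun hV => ?_, fun e => e.1 ▸ e.2 ▸ hp⟩, key⟩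
  obtain rfl := (key V).1 hV.1
  exact ⟨rfl, h.eq_of_isAdjointBijectivePair hV hp⟩

theorem characterisation_maximal (h : BoundarySystem T Tt W L Lt μ pa pb va vb)
    (ha : pa ≤ 0) (hb : 0 ≤ pb) :
    (∀ V Vt, IsAdjointBijectivePair T Tt V Vt ↔ V = W ∧ Vt = T.closure.domain) ∧
      ∀ V, IsBijectiveRealisation T Tt V ↔ V = W := by
  have hc := h.swap.characterisation_minimal (neg_nonneg.2 ha) (neg_nonpos.2 hb)
  rw [h.closure_domain_swap] at hc
  have hp : ∀ V Vt, IsAdjointBijectivePair T Tt V Vt ↔ V = W ∧ Vt = T.closure.domain :=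
    fun V Vt => by rw [isAdjointBijectivePair_comm, hc.1, and_comm]
  refine ⟨hp, fun V => ⟨fun hV => ?_, fun e => ?_⟩⟩
  · exact h.eq_of_le_of_bijective hV ((hp W _).2 ⟨rfl, rfl⟩).1 (h.isBetween_iff.1 hV.1).2
  · exact ((hp V _).2 ⟨e, rfl⟩).1

/-- Here the bijective realisation of the second operator lives on all of `W`, so the quotient is
trivial. In the rank lemmas that follow the reference domain is the minimal one, and the quotient
map collects the traces with nonzero coefficient. -/
theorem rank_kernel_adj_eq_zero (h : BoundarySystem T Tt W L Lt μ pa pb va vb)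
    (ha : 0 ≤ pa) (hb : pb ≤ 0) : Module.rank ℂ (kernel T†) = 0 := by
  rw [h.toMaximalPair.swap.rank_kernel (h.isAdjointBijectivePair_minimal ha hb).2.1.2
    (0 : W →ₗ[ℂ] PUnit) (fun x => ⟨0, rfl⟩) (fun u _ => u.2) fun _ _ => rfl]
  simp

theorem rank_kernel_eq_zero (h : BoundarySystem T Tt W L Lt μ pa pb va vb)
    (ha : pa = 0) (hb : pb = 0) : Module.rank ℂ (kernel Tt†) = 0 := by
  rw [h.rank_kernel (h.isAdjointBijectivePair_minimal ha.ge hb.le).1.2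
    (0 : W →ₗ[ℂ] PUnit) (fun x => ⟨0, rfl⟩)
    (fun u _ => h.mem_closure_domain_iff.2 ⟨fun h' => absurd ha h', fun h' => absurd hb h'⟩)
    fun _ _ => rfl]
  simp

theorem rank_kernel_eq_one_left (h : BoundarySystem T Tt W L Lt μ pa pb va vb)
    (ha : 0 < pa) (hb : pb = 0) : Module.rank ℂ (kernel Tt†) = 1 := by
  rw [h.rank_kernel (h.isAdjointBijectivePair_minimal ha.le hb.le).1.2 va
    (fun z => (h.surj z 0).imp fun u hu => hu.1 ha.ne')
    (fun u hu => h.mem_closure_domain_iff.2 ⟨fun _ => hu, fun h' => absurd hb h'⟩)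
    fun u hu => (h.mem_closure_domain_iff.1 hu).1 ha.ne']
  simp

theorem rank_kernel_eq_one_right (h : BoundarySystem T Tt W L Lt μ pa pb va vb)
    (ha : pa = 0) (hb : pb < 0) : Module.rank ℂ (kernel Tt†) = 1 := by
  rw [h.rank_kernel (h.isAdjointBijectivePair_minimal ha.ge hb.le).1.2 vb
    (fun z => (h.surj 0 z).imp fun u hu => hu.2 hb.ne)
    (fun u hu => h.mem_closure_domain_iff.2 ⟨fun h' => absurd ha h', fun _ => hu⟩)
    fun u hu => (h.mem_closure_domain_iff.1 hu).2 hb.ne]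
  simp

theorem rank_kernel_eq_two (h : BoundarySystem T Tt W L Lt μ pa pb va vb)
    (ha : 0 < pa) (hb : pb < 0) : Module.rank ℂ (kernel Tt†) = 2 := by
  rw [h.rank_kernel (h.isAdjointBijectivePair_minimal ha.le hb.le).1.2 (va.prod vb)
    (fun z => (h.surj z.1 z.2).imp fun u hu => Prod.ext (hu.1 ha.ne') (hu.2 hb.ne))
    (fun u hu => h.mem_closure_domain_iff.2
      ⟨fun _ => congrArg Prod.fst hu, fun _ => congrArg Prod.snd hu⟩)
    fun u hu => Prod.ext ((h.mem_closure_domain_iff.1 hu).1 ha.ne')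
      ((h.mem_closure_domain_iff.1 hu).2 hb.ne)]
  simp [one_add_one_eq_two]

/-! #### Indefinite boundary form -/

theorem isBetween_lineSpace (h : BoundarySystem T Tt W L Lt μ pa pb va vb)
    (ha : pa ≠ 0) (hb : pb ≠ 0) (γ δ : ℂ) : IsBetween T Tt (lineSpace va vb γ δ) := by
  refine h.isBetween_iff.2 ⟨fun x hx => ?_, lineSpace_le _ _ _ _⟩
  have hxW := h.closure_domain_le hx
  have := (h.mem_closure_domain_iff (u := ⟨x, hxW⟩)).1 hx
  exact mem_lineSpace.2 ⟨hxW, by rw [this.1 ha, this.2 hb, mul_zero, mul_zero]⟩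

/-- The elements of `lineSpace va vb γ δ` are those whose trace pair `(va, vb)` lies on the line
through `(γ, δ)`. Hypothesis `e` says that the two spanning vectors are orthogonal for the
nondegenerate form on `ℂ²`, where the complement of a line is a line. -/
theorem mem_lineSpace_iff_orthogonal (h : BoundarySystem T Tt W L Lt μ pa pb va vb)
    (ha : pa ≠ 0) (hb : pb ≠ 0) {γ δ γ' δ' : ℂ} (h0 : (γ, δ) ≠ 0) (h0' : (γ', δ') ≠ 0)
    (e : pa * γ' * starRingEnd ℂ γ = pb * δ' * starRingEnd ℂ δ) (v : W) :
    (v : H) ∈ lineSpace va vb γ' δ' ↔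
      ∀ u : W, (u : H) ∈ lineSpace va vb γ δ → bform L Lt u v = 0 := by
  have ha' : (pa : ℂ) ≠ 0 := Complex.ofReal_ne_zero.2 ha
  have hb' : (pb : ℂ) ≠ 0 := Complex.ofReal_ne_zero.2 hb
  have par : ∀ {γ δ x y : ℂ}, (γ, δ) ≠ 0 → γ * y = δ * x → ∃ t, x = t * γ ∧ y = t * δ := by
    intro γ δ x y h0 h1
    by_cases hγ : γ = 0
    · have hδ : δ ≠ 0 := fun hδ => h0 (by rw [hγ, hδ]; rfl)
      subst hγ
      refine ⟨y / δ, ?_, by field_simp⟩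
      rw [zero_mul, eq_comm, mul_eq_zero] at h1
      simp [h1.resolve_left hδ]
    · refine ⟨x / γ, by field_simp, ?_⟩
      field_simp
      linear_combination h1
  constructor
  · intro hv u hu
    rw [coe_mem_lineSpace] at hv hu
    obtain ⟨t, h1, h2⟩ := par h0 hu
    obtain ⟨t', h3, h4⟩ := par h0' hv
    rw [h.green, h1, h2, h3, h4]
    have e' := congrArg (starRingEnd ℂ) e
    simp only [map_mul, Complex.conj_ofReal, Complex.conj_conj] at e' ⊢
    linear_combination -(t * starRingEnd ℂ t') * e'
  · intro hv
    obtain ⟨u, hua, hub⟩ := h.surj γ δ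
    have := hv u (coe_mem_lineSpace.2 (by rw [hua ha, hub hb, mul_comm]))
    rw [h.green, hua ha, hub hb] at this
    have e' := congrArg (starRingEnd ℂ) this
    simp only [map_mul, map_sub, Complex.conj_ofReal, Complex.conj_conj, map_zero] at e'
    rw [coe_mem_lineSpace]
    by_cases hγ : γ = 0
    · have hδ : δ ≠ 0 := fun hδ => h0 (by rw [hγ, hδ]; rfl)
      have hδc : starRingEnd ℂ δ ≠ 0 := (map_ne_zero _).2 hδ
      rw [hγ] at e e'
      simp only [map_zero, mul_zero, zero_mul, sub_zero] at e e'
      have h5 : δ' = 0 := by simpa [hb', hδc] using e.symm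
      have h6 : vb v = 0 := by simpa [hb', hδc] using e'
      rw [h5, h6, mul_zero, zero_mul]
    · have hγc : starRingEnd ℂ γ ≠ 0 := (map_ne_zero _).2 hγ
      refine mul_left_cancel₀ (mul_ne_zero ha' hγc) ?_
      linear_combination vb v * e + δ' * e'

/-- Because `pb s² = pa`, the vector `(1, s)` is isotropic and its line is its own complement; the
form vanishes on it, so both sign conditions hold trivially. -/
theorem isAdjointBijectivePair_ref (h : BoundarySystem T Tt W L Lt μ pa pb va vb)
    (ha : pa ≠ 0) (hb : pb ≠ 0) {s : ℝ} (hs : pb * s ^ 2 = pa) :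
    IsAdjointBijectivePair T Tt (lineSpace va vb 1 s) (lineSpace va vb 1 s) := by
  have h0 : ((1 : ℂ), (s : ℂ)) ≠ 0 := fun h' => one_ne_zero (congrArg Prod.fst h')
  have e : (pa : ℂ) * 1 * starRingEnd ℂ 1 = pb * s * starRingEnd ℂ s := by
    rw [map_one, Complex.conj_ofReal, ← hs]
    push_cast
    ring
  have h1 := h.mem_lineSpace_iff_orthogonal ha hb h0 h0 e
  have hz : ∀ u v : W, (u : H) ∈ lineSpace va vb 1 s → (v : H) ∈ lineSpace va vb 1 s →
      bform L Lt u v = 0 := fun u v hu hv => (h1 v).1 hv u hu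
  have hz' : ∀ u v, bform L Lt u v = 0 → bform L Lt v u = 0 := fun u v huv => by
    have := congrArg (starRingEnd ℂ) huv
    rw [h.green] at this ⊢
    simp only [map_sub, map_mul, Complex.conj_ofReal, Complex.conj_conj, map_zero] at this
    linear_combination this
  refine h.isAdjointBijectivePair_of_orthogonal h.pos h.coercive (h.isBetween_lineSpace ha hb _ _)
    (h.swap.isBetween_lineSpace (neg_ne_zero.2 ha) (neg_ne_zero.2 hb) _ _) h1
    (fun u => (h1 u).trans ⟨fun hu v hv => hz' _ _ (hu v hv), fun hu v hv => hz' _ _ (hu v hv)⟩)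
    (fun u hu => ?_) fun u hu => ?_
  all_goals rw [hz u u hu hu, Complex.zero_re]

theorem rank_kernel_eq_one (h : BoundarySystem T Tt W L Lt μ pa pb va vb)
    (ha : pa ≠ 0) (hb : pb ≠ 0) {s : ℝ} (hs : pb * s ^ 2 = pa) :
    Module.rank ℂ (kernel Tt†) = 1 := by
  rw [h.rank_kernel (h.isAdjointBijectivePair_ref ha hb hs).1.2 (vb - (s : ℂ) • va)
    (fun z => (h.surj 0 z).imp fun u hu => by simp [hu.1 ha, hu.2 hb])
    (fun u hu => coe_mem_lineSpace.2 ?_) fun u hu => ?_]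
  · simp
  · rw [one_mul]
    exact sub_eq_zero.1 hu
  · have := coe_mem_lineSpace.1 hu
    rw [one_mul] at this
    exact sub_eq_zero.2 this

/-- A kernel element with zero jump would lie in the reference domain, where the operator is
injective. -/
theorem jump_ne_zero (h : BoundarySystem T Tt W L Lt μ pa pb va vb)
    (ha : pa ≠ 0) (hb : pb ≠ 0) {s : ℝ} (hs : pb * s ^ 2 = pa) {φ : W} (hφ : L φ = 0)
    (hφ0 : φ ≠ 0) : vb φ - s * va φ ≠ 0 := fun h0 =>
  hφ0 <| (h.bijective_domRestrict_iff.1 (h.isAdjointBijectivePair_ref ha hb hs).1.2).1 φ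
    (coe_mem_lineSpace.2 (by rw [one_mul]; exact sub_eq_zero.1 h0)) hφ

/-- The kernel of `L` is `ℂφ`, since `φ` has nonzero jump and any kernel element can be reduced by a
multiple of `φ` into the reference domain. A line space not containing `φ` is therefore another
complement of the kernel. -/
theorem isBijectiveRealisation_lineSpace (h : BoundarySystem T Tt W L Lt μ pa pb va vb)
    (ha : pa ≠ 0) (hb : pb ≠ 0) {s : ℝ} (hs : pb * s ^ 2 = pa) {φ : W} (hφ : L φ = 0)
    {γ δ : ℂ} (hne : γ * vb φ - δ * va φ ≠ 0) :
    IsBijectiveRealisation T Tt (lineSpace va vb γ δ) := by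
  have hφ0 : φ ≠ 0 := fun h0 => hne (by simp [h0])
  have href := h.bijective_domRestrict_iff.1 (h.isAdjointBijectivePair_ref ha hb hs).1.2
  have hJ := h.jump_ne_zero ha hb hs hφ hφ0
  refine ⟨h.isBetween_lineSpace ha hb _ _, h.bijective_domRestrict_iff.2 ⟨fun u hu h0 => ?_,
    fun f => ?_⟩⟩
  · have hz := href.1 (u - ((vb u - s * va u) / (vb φ - s * va φ)) • φ) (coe_mem_lineSpace.2 (by
      simp only [map_sub, map_smul, smul_eq_mul]
      field_simp
      ring)) (by simp [h0, hφ])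
    rw [sub_eq_zero] at hz
    rw [hz] at hu ⊢
    rw [coe_mem_lineSpace] at hu
    simp only [map_smul, smul_eq_mul] at hu
    have h1 : ((vb u - s * va u) / (vb φ - s * va φ)) * (γ * vb φ - δ * va φ) = 0 := by
      linear_combination hu
    rw [(mul_eq_zero.1 h1).resolve_right hne, zero_smul]
  · obtain ⟨u, -, hu⟩ := href.2 f
    refine ⟨u - ((γ * vb u - δ * va u) / (γ * vb φ - δ * va φ)) • φ, coe_mem_lineSpace.2 ?_, ?_⟩
    · simp only [map_sub, map_smul, smul_eq_mul]
      field_simp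
      ring
    · simp [hu, hφ]

/-- A bijective realisation on `V` gives `W = V ⊕ ℂφ`. As `V` contains the minimal domain, the
`φ`-coefficient depends only on the traces, linearly, and `V` is its zero set. The numbers `xa`,
`xb` are the values of this functional on elements with traces `(1, 0)` and `(0, 1)`. -/
theorem exists_eq_lineSpace (h : BoundarySystem T Tt W L Lt μ pa pb va vb)
    (ha : pa ≠ 0) (hb : pb ≠ 0) {s : ℝ} (hs : pb * s ^ 2 = pa) {φ : W} (hφ : L φ = 0)
    (hφ0 : φ ≠ 0) {V : Submodule ℂ H} (hV : IsBijectiveRealisation T Tt V) :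
    ∃ γ δ, V = lineSpace va vb γ δ ∧ γ * vb φ - δ * va φ ≠ 0 := by
  have hbij := h.bijective_domRestrict_iff.1 hV.2
  have hbet := h.isBetween_iff.1 hV.1
  have href := h.bijective_domRestrict_iff.1 (h.isAdjointBijectivePair_ref ha hb hs).1.2
  have hJ := h.jump_ne_zero ha hb hs hφ hφ0
  have hdec : ∀ u : W, ∃ x : ℂ, ((u - x • φ : W) : H) ∈ V := by
    intro u
    obtain ⟨w, hw, hLw⟩ := hbij.2 (L u)
    have hz := href.1 (u - w - ((vb (u - w) - s * va (u - w)) / (vb φ - s * va φ)) • φ)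
      (coe_mem_lineSpace.2 (by
        simp only [map_sub, map_smul, smul_eq_mul]
        field_simp
        ring)) (by simp [hLw, hφ])
    refine ⟨(vb (u - w) - s * va (u - w)) / (vb φ - s * va φ), ?_⟩
    rw [sub_right_comm, sub_eq_zero] at hz
    rwa [hz]
  have hφV : (φ : H) ∉ V := fun h' => hφ0 (hbij.1 φ h' hφ)
  obtain ⟨ea, ha1, ha2⟩ := h.surj 1 0
  obtain ⟨eb, hb1, hb2⟩ := h.surj 0 1
  obtain ⟨xa, hxa⟩ := hdec ea
  obtain ⟨xb, hxb⟩ := hdec eb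
  have hmem : ∀ u : W, ((u - (va u * xa + vb u * xb) • φ : W) : H) ∈ V := by
    intro u
    have hmin : ((u - va u • ea - vb u • eb : W) : H) ∈ V := hbet.1 <|
      h.mem_closure_domain_iff.2 ⟨fun _ => by simp [ha1 ha, hb1 ha],
        fun _ => by simp [ha2 hb, hb2 hb]⟩
    have := V.add_mem hmin (V.add_mem (V.smul_mem (va u) hxa) (V.smul_mem (vb u) hxb))
    convert this using 1
    simp only [Submodule.coe_sub, Submodule.coe_smul]
    module
  have hiff : ∀ u : W, (u : H) ∈ V ↔ va u * xa + vb u * xb = 0 := by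
    intro u
    have h1 := hmem u
    constructor
    · intro hu
      by_contra hne
      have h2 := V.sub_mem hu h1
      rw [Submodule.coe_sub, sub_sub_cancel, Submodule.coe_smul] at h2
      exact hφV ((V.smul_mem_iff hne).1 h2)
    · intro h0
      rwa [h0, zero_smul, sub_zero] at h1
  refine ⟨xb, -xa, ?_, fun h0 => hφV ((hiff φ).2 (by linear_combination h0))⟩
  ext x
  rw [mem_lineSpace]
  constructor
  · intro hx
    exact ⟨hbet.2 hx, by linear_combination (hiff ⟨x, hbet.2 hx⟩).1 hx⟩
  · rintro ⟨hx, hx'⟩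
    exact (hiff ⟨x, hx⟩).2 (by linear_combination hx')

end BoundarySystem

end Boundary

/-! ### The explicit families of boundary conditions parametrised by `k = c + id`. -/

section Family

variable {H : Type*} [NormedAddCommGroup H] [InnerProductSpace ℂ H] [CompleteSpace H]
  {T Tt : H →ₗ.[ℂ] H} {W : Submodule ℂ H} {L Lt : W →ₗ[ℂ] H}

/-- The space of all `u` with
`(pb conj vb(φt) / ‖φt‖² - k / Δ) vb(u) = (pa conj va(φt) / ‖φt‖² - k s / Δ) va(u)`, where
`Δ = vb(φ) - s va(φ)`. -/
noncomputable def familyDom (va vb : W →ₗ[ℂ] ℂ) (pa pb s : ℝ) (φ φt : W) (k : ℂ) :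
    Submodule ℂ H :=
  lineSpace va vb
    ((pb : ℂ) * starRingEnd ℂ (vb φt) / (‖(φt : H)‖ : ℂ) ^ 2 - k / (vb φ - s * va φ))
    ((pa : ℂ) * starRingEnd ℂ (va φt) / (‖(φt : H)‖ : ℂ) ^ 2 - k * s / (vb φ - s * va φ))

/-- The space of all `u` with
`(pb conj vb(φ) + ‖φt‖² conj k / Δt) vb(u) = (pa conj va(φ) + ‖φt‖² conj k s / Δt) va(u)`, where
`Δt = vb(φt) - s va(φt)`. -/
noncomputable def familyAdjDom (va vb : W →ₗ[ℂ] ℂ) (pa pb s : ℝ) (φ φt : W) (k : ℂ) :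
    Submodule ℂ H :=
  lineSpace va vb
    ((pb : ℂ) * starRingEnd ℂ (vb φ) +
      (‖(φt : H)‖ : ℂ) ^ 2 * starRingEnd ℂ k / (vb φt - s * va φt))
    ((pa : ℂ) * starRingEnd ℂ (va φ) +
      (‖(φt : H)‖ : ℂ) ^ 2 * starRingEnd ℂ k * s / (vb φt - s * va φt))

namespace BoundarySystem

variable {μ pa pb : ℝ} {va vb : W →ₗ[ℂ] ℂ}

/-- The boundary functional attached to `φt` sends `u` to `⟨φt, L u⟩`, so it vanishes at `φ`. -/
theorem green_kernels (h : BoundarySystem T Tt W L Lt μ pa pb va vb) {φ φt : W} (hφ : L φ = 0)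
    (hφt : Lt φt = 0) :
    (pb : ℂ) * starRingEnd ℂ (vb φt) * vb φ = pa * starRingEnd ℂ (va φt) * va φ := by
  have := h.green φ φt
  rw [bform, hφ, hφt, inner_zero_right, inner_zero_left, sub_zero] at this
  linear_combination -this

/-- At `φt` that functional equals `⟨φt, (L + Lt) φt⟩`, whose real part is positive by coercivity.
-/
theorem green_kernel_adj_ne_zero (h : BoundarySystem T Tt W L Lt μ pa pb va vb) {φt : W}
    (hφt : Lt φt = 0) (hφt0 : φt ≠ 0) :
    (pb : ℂ) * starRingEnd ℂ (vb φt) * vb φt - pa * starRingEnd ℂ (va φt) * va φt ≠ 0 := by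
  intro h0
  have h1 : bform L Lt φt φt = 0 := by
    rw [h.green]
    linear_combination h0
  rw [bform, hφt, inner_zero_left, sub_zero] at h1
  have h2 := h.coercive φt
  rw [hφt, add_zero, h1, Complex.zero_re] at h2
  have h3 := h.pos
  have h4 : 0 < ‖(φt : H)‖ := norm_pos_iff.2 fun h' => hφt0 (Subtype.ext h')
  have : 0 < 2 * μ * ‖(φt : H)‖ ^ 2 := by positivity
  linarith

variable {s : ℝ} {φ φt : W}

/-- The functional `u ↦ ⟨φt, L u⟩` vanishes at `φ`. If it also vanished in the direction `(1, s)`,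
it would vanish identically, contradicting its value at `φt`. Hence it and the jump form a basis of
the boundary functionals. -/
theorem det_ne_zero (h : BoundarySystem T Tt W L Lt μ pa pb va vb)
    (ha : pa ≠ 0) (hb : pb ≠ 0) (hs : pb * s ^ 2 = pa) (hφ : L φ = 0) (hφ0 : φ ≠ 0)
    (hφt : Lt φt = 0) (hφt0 : φt ≠ 0) :
    (pb : ℂ) * starRingEnd ℂ (vb φt) * s - pa * starRingEnd ℂ (va φt) ≠ 0 := by
  intro h0
  have hJ := h.jump_ne_zero ha hb hs hφ hφ0
  have h1 := h.green_kernels hφ hφt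
  have h2 : (pb : ℂ) * starRingEnd ℂ (vb φt) * (vb φ - s * va φ) = 0 := by
    linear_combination h1 - va φ * h0
  have h3 := (mul_eq_zero.1 h2).resolve_right hJ
  have h4 : (pa : ℂ) * starRingEnd ℂ (va φt) = 0 := by
    linear_combination s * h3 - h0
  exact h.green_kernel_adj_ne_zero hφt hφt0 (by rw [h3, h4, zero_mul, zero_mul, sub_zero])

theorem isBijectiveRealisation_iff (h : BoundarySystem T Tt W L Lt μ pa pb va vb)
    (ha : pa ≠ 0) (hb : pb ≠ 0) (hs : pb * s ^ 2 = pa) (hφ : L φ = 0) (hφ0 : φ ≠ 0)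
    (hφt : Lt φt = 0) (hφt0 : φt ≠ 0) (V : Submodule ℂ H) :
    IsBijectiveRealisation T Tt V ↔ V = lineSpace va vb 1 s ∨
      ∃ k, k ≠ 0 ∧ V = familyDom va vb pa pb s φ φt k := by
  have hJ := h.jump_ne_zero ha hb hs hφ hφ0
  have h1 := h.green_kernels hφ hφt
  have hdet := h.det_ne_zero ha hb hs hφ hφ0 hφt hφt0
  have hN : (‖(φt : H)‖ : ℂ) ≠ 0 :=
    Complex.ofReal_ne_zero.2 (norm_ne_zero_iff.2 fun h' => hφt0 (Subtype.ext h'))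
  constructor
  · intro hV
    obtain ⟨γ, δ, rfl, hne⟩ := h.exists_eq_lineSpace ha hb hs hφ hφ0 hV
    set J := vb φ - s * va φ with hJdef
    set N := (‖(φt : H)‖ : ℂ) ^ 2 with hNdef
    have hN2 : N ≠ 0 := pow_ne_zero 2 hN
    set γ₀ := (pb : ℂ) * starRingEnd ℂ (vb φt) with hγ₀
    set δ₀ := (pa : ℂ) * starRingEnd ℂ (va φt) with hδ₀
    -- Expand `(γ, δ) = (p/N) (γ₀, δ₀) + q (1, s)`; applying both sides to traces `(1, s)`
    -- eliminates `q`. Evaluation at `φ` gives `q J ≠ 0`, so `p = 0` is the reference domain and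
    -- otherwise division by `p` (with the factor `N` absorbed in the family) reads off `k`.
    obtain ⟨p, hp⟩ : ∃ p, p * (γ₀ * s - δ₀) = N * (γ * s - δ) :=
      ⟨N * (γ * s - δ) / (γ₀ * s - δ₀), div_mul_cancel₀ _ hdet⟩
    obtain ⟨q, hq⟩ : ∃ q, N * q = N * γ - p * γ₀ :=
      ⟨(N * γ - p * γ₀) / N, mul_div_cancel₀ _ hN2⟩
    have hγ : N * γ = p * γ₀ + N * q := by linear_combination -hq
    have hδ : N * δ = p * δ₀ + N * (q * s) := by linear_combination hp - s * hq
    have hqJ : N * (γ * vb φ - δ * va φ) = N * (q * J) := by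
      rw [hJdef]
      linear_combination vb φ * hγ - va φ * hδ + p * h1
    have hq0 : q ≠ 0 := fun h0 => hne (mul_left_cancel₀ hN2 (by rw [hqJ, h0]; ring))
    by_cases hp0 : p = 0
    · left
      rw [hp0, zero_mul, zero_add] at hγ hδ
      rw [mul_left_cancel₀ hN2 hγ, mul_left_cancel₀ hN2 hδ]
      simpa using lineSpace_smul va vb 1 s hq0
    · right
      refine ⟨-(q * J) / p, div_ne_zero (neg_ne_zero.2 (mul_ne_zero hq0 hJ)) hp0, ?_⟩
      rw [familyDom, ← hNdef, ← hJdef, ← hγ₀, ← hδ₀]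
      refine Eq.trans ?_ (lineSpace_smul va vb _ _ hp0)
      congr 1
      · field_simp
        linear_combination hγ
      · field_simp
        linear_combination hδ
  · rintro (rfl | ⟨k, hk, rfl⟩)
    · exact (h.isAdjointBijectivePair_ref ha hb hs).1
    · refine h.isBijectiveRealisation_lineSpace ha hb hs hφ (φ := φ) fun h0 => hk ?_
      set J := vb φ - s * va φ with hJdef
      field_simp at h0
      have h2 : (‖(φt : H)‖ : ℂ) ^ 2 * J * k = 0 := by
        rw [hJdef] at h0 ⊢
        linear_combination J * h1 - h0
      simpa [hN, hJ] using h2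

theorem isAdjointBijectivePair_family (h : BoundarySystem T Tt W L Lt μ pa pb va vb)
    (ha : pa ≠ 0) (hb : pb ≠ 0) (hs : pb * s ^ 2 = pa) (hφ : L φ = 0) (hφ0 : φ ≠ 0)
    (hφt : Lt φt = 0) (hφt0 : φt ≠ 0) {k : ℂ} (hk : k ≠ 0) :
    IsAdjointBijectivePair T Tt (familyDom va vb pa pb s φ φt k)
      (familyAdjDom va vb pa pb s φ φt k) := by
  have hJ := h.jump_ne_zero ha hb hs hφ hφ0
  have ha' := neg_ne_zero.2 ha
  have hb' := neg_ne_zero.2 hb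
  have hs' : -pb * s ^ 2 = -pa := by linear_combination -hs
  have hJt := h.swap.jump_ne_zero ha' hb' hs' hφt hφt0
  have h1 := h.green_kernels hφ hφt
  have hN : (‖(φt : H)‖ : ℂ) ≠ 0 :=
    Complex.ofReal_ne_zero.2 (norm_ne_zero_iff.2 fun h' => hφt0 (Subtype.ext h'))
  have hbr := (h.isBijectiveRealisation_iff ha hb hs hφ hφ0 hφt hφt0 _).2
    (Or.inr ⟨k, hk, rfl⟩)
  have hkc : starRingEnd ℂ k ≠ 0 := (map_ne_zero _).2 hk
  have hsc : (pb : ℂ) * s ^ 2 = pa := by exact_mod_cast hs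
  set γ := (pb : ℂ) * starRingEnd ℂ (vb φt) / (‖(φt : H)‖ : ℂ) ^ 2 - k / (vb φ - s * va φ) with hγ
  set δ := (pa : ℂ) * starRingEnd ℂ (va φt) / (‖(φt : H)‖ : ℂ) ^ 2 - k * s / (vb φ - s * va φ)
    with hδ
  set γ' := (pb : ℂ) * starRingEnd ℂ (vb φ) +
      (‖(φt : H)‖ : ℂ) ^ 2 * starRingEnd ℂ k / (vb φt - s * va φt) with hγ'
  set δ' := (pa : ℂ) * starRingEnd ℂ (va φ) +
      (‖(φt : H)‖ : ℂ) ^ 2 * starRingEnd ℂ k * s / (vb φt - s * va φt) with hδ'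
  have hev : γ * vb φ - δ * va φ = -k := by
    rw [hγ, hδ]
    field_simp
    linear_combination (vb φ - s * va φ) * h1
  have hev' : γ' * vb φt - δ' * va φt = (‖(φt : H)‖ : ℂ) ^ 2 * starRingEnd ℂ k := by
    have h2 := congrArg (starRingEnd ℂ) h1
    simp only [map_mul, Complex.conj_ofReal, Complex.conj_conj] at h2
    rw [hγ', hδ']
    field_simp
    linear_combination (vb φt - s * va φt) * h2
  have h0 : (γ, δ) ≠ 0 := fun h0 => hk <| by
    have e1 : γ = 0 := congrArg Prod.fst h0
    have e2 : δ = 0 := congrArg Prod.snd h0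
    rw [e1, e2] at hev
    linear_combination hev
  have hne' : γ' * vb φt - δ' * va φt ≠ 0 := hev' ▸ mul_ne_zero (pow_ne_zero 2 hN) hkc
  have h0' : (γ', δ') ≠ 0 := fun h0 => hne' <| by
    have e1 : γ' = 0 := congrArg Prod.fst h0
    have e2 : δ' = 0 := congrArg Prod.snd h0
    rw [e1, e2]
    ring
  -- The product of the two kernel parts vanishes by Green, the product of the two jump parts by `pb
  -- s² = pa`, and the two mixed products are `±pa pb conj k`, which cancel.
  have horth : pa * γ' * starRingEnd ℂ γ = pb * δ' * starRingEnd ℂ δ := by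
    have hJc : starRingEnd ℂ (vb φ) - s * starRingEnd ℂ (va φ) ≠ 0 := by
      have := (map_ne_zero (starRingEnd ℂ)).2 hJ
      simpa using this
    have h2 := congrArg (starRingEnd ℂ) h1
    simp only [map_mul, Complex.conj_ofReal, Complex.conj_conj] at h2
    rw [hγ, hδ, hγ', hδ', ← hsc]
    rw [← hsc] at h2
    simp only [map_sub, map_mul, map_div₀, map_pow, Complex.conj_ofReal, Complex.conj_conj]
    have i1 := inv_mul_cancel₀ hJc
    have i2 := inv_mul_cancel₀ hJt
    have i3 := mul_inv_cancel₀ (pow_ne_zero 2 hN)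
    simp only [div_eq_mul_inv]
    linear_combination (pb : ℂ) ^ 2 * s ^ 2 * ((‖(φt : H)‖ : ℂ) ^ 2)⁻¹ * h2 -
      (pb : ℂ) ^ 2 * s ^ 2 * starRingEnd ℂ k * i1 +
      (pb : ℂ) ^ 2 * s ^ 2 * starRingEnd ℂ k * (‖(φt : H)‖ : ℂ) ^ 2 *
        ((‖(φt : H)‖ : ℂ) ^ 2)⁻¹ * i2 + (pb : ℂ) ^ 2 * s ^ 2 * starRingEnd ℂ k * i3
  have hbr' := h.swap.isBijectiveRealisation_lineSpace ha' hb' hs' hφt hne'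
  refine ⟨hbr, hbr', (h.adjoint_domRestrict_eq_iff hbr.1).2
      (h.mem_lineSpace_iff_orthogonal ha hb h0 h0' horth),
    (h.toMaximalPair.swap.adjoint_domRestrict_eq_iff hbr'.1).2
      (h.swap.mem_lineSpace_iff_orthogonal ha' hb' h0' h0 ?_)⟩
  have h3 := congrArg (starRingEnd ℂ) horth
  simp only [map_mul, Complex.conj_ofReal, Complex.conj_conj] at h3
  push_cast
  linear_combination -h3

theorem isAdjointBijectivePair_iff (h : BoundarySystem T Tt W L Lt μ pa pb va vb)
    (ha : pa ≠ 0) (hb : pb ≠ 0) (hs : pb * s ^ 2 = pa) (hφ : L φ = 0) (hφ0 : φ ≠ 0)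
    (hφt : Lt φt = 0) (hφt0 : φt ≠ 0) (V Vt : Submodule ℂ H) :
    IsAdjointBijectivePair T Tt V Vt ↔
      (V = lineSpace va vb 1 s ∧ Vt = lineSpace va vb 1 s) ∨
      ∃ k, k ≠ 0 ∧ V = familyDom va vb pa pb s φ φt k ∧
        Vt = familyAdjDom va vb pa pb s φ φt k := by
  constructor
  · intro hV
    rcases (h.isBijectiveRealisation_iff ha hb hs hφ hφ0 hφt hφt0 V).1 hV.1 with rfl | ⟨k, hk, rfl⟩
    · exact Or.inl ⟨rfl, h.eq_of_isAdjointBijectivePair hV (h.isAdjointBijectivePair_ref ha hb hs)⟩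
    · exact Or.inr ⟨k, hk, rfl, h.eq_of_isAdjointBijectivePair hV
        (h.isAdjointBijectivePair_family ha hb hs hφ hφ0 hφt hφt0 hk)⟩
  · rintro (⟨rfl, rfl⟩ | ⟨k, hk, rfl, rfl⟩)
    · exact h.isAdjointBijectivePair_ref ha hb hs
    · exact h.isAdjointBijectivePair_family ha hb hs hφ hφ0 hφt hφt0 hk

/-- An element with traces `(1, s)` separates the spaces: the term containing `k` drops out there
and the determinant remains. -/
theorem familyDom_ne_ref (h : BoundarySystem T Tt W L Lt μ pa pb va vb)
    (ha : pa ≠ 0) (hb : pb ≠ 0) (hs : pb * s ^ 2 = pa) (hφ : L φ = 0) (hφ0 : φ ≠ 0)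
    (hφt : Lt φt = 0) (hφt0 : φt ≠ 0) (k : ℂ) :
    familyDom va vb pa pb s φ φt k ≠ lineSpace va vb 1 s := by
  intro e
  have hJ := h.jump_ne_zero ha hb hs hφ hφ0
  have hN : (‖(φt : H)‖ : ℂ) ≠ 0 :=
    Complex.ofReal_ne_zero.2 (norm_ne_zero_iff.2 fun h' => hφt0 (Subtype.ext h'))
  obtain ⟨u, hua, hub⟩ := h.surj 1 s
  have hu : (u : H) ∈ lineSpace va vb 1 s := by
    rw [coe_mem_lineSpace, hua ha, hub hb, mul_comm]
  rw [← e, familyDom, coe_mem_lineSpace, hua ha, hub hb] at hu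
  refine h.det_ne_zero ha hb hs hφ hφ0 hφt hφt0 ?_
  field_simp at hu
  refine (mul_eq_zero.1 ?_).resolve_right hJ
  linear_combination hu

theorem familyDom_injective (h : BoundarySystem T Tt W L Lt μ pa pb va vb)
    (ha : pa ≠ 0) (hb : pb ≠ 0) (hs : pb * s ^ 2 = pa) (hφ : L φ = 0) (hφ0 : φ ≠ 0)
    (hφt : Lt φt = 0) (hφt0 : φt ≠ 0) :
    Function.Injective (familyDom va vb pa pb s φ φt) := by
  intro k k' e
  have hJ := h.jump_ne_zero ha hb hs hφ hφ0
  have hN : (‖(φt : H)‖ : ℂ) ≠ 0 :=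
    Complex.ofReal_ne_zero.2 (norm_ne_zero_iff.2 fun h' => hφt0 (Subtype.ext h'))
  obtain ⟨u, hua, hub⟩ := h.surj
    ((pb : ℂ) * starRingEnd ℂ (vb φt) / (‖(φt : H)‖ : ℂ) ^ 2 - k / (vb φ - s * va φ))
    ((pa : ℂ) * starRingEnd ℂ (va φt) / (‖(φt : H)‖ : ℂ) ^ 2 - k * s / (vb φ - s * va φ))
  have hu : (u : H) ∈ familyDom va vb pa pb s φ φt k := by
    rw [familyDom, coe_mem_lineSpace, hua ha, hub hb, mul_comm]
  rw [e, familyDom, coe_mem_lineSpace, hua ha, hub hb] at hu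
  have hdet := h.det_ne_zero ha hb hs hφ hφ0 hφt hφt0
  set γ₀ := (pb : ℂ) * starRingEnd ℂ (vb φt)
  set δ₀ := (pa : ℂ) * starRingEnd ℂ (va φt)
  set J := vb φ - s * va φ
  field_simp at hu
  have h2 : (k - k') * (γ₀ * s - δ₀) = 0 := by
    have hNJ : (‖(φt : H)‖ : ℂ) ^ 2 * J ≠ 0 := mul_ne_zero (pow_ne_zero 2 hN) hJ
    refine mul_left_cancel₀ hNJ ?_
    linear_combination -hu
  exact sub_eq_zero.1 ((mul_eq_zero.1 h2).resolve_right hdet)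

end BoundarySystem

end Family

end Friedrichs

/-! ### Absolutely continuous functions with values in a normed space -/

/-- Transfers absolute continuity through Lipschitz maps, between different codomains. -/
theorem AbsolutelyContinuousOnInterval.of_dist_le {X Y : Type*} [PseudoMetricSpace X]
    [PseudoMetricSpace Y] {f : ℝ → X} {g : ℝ → Y} {a b K : ℝ}
    (hg : AbsolutelyContinuousOnInterval g a b)
    (h : ∀ x ∈ uIcc a b, ∀ y ∈ uIcc a b, dist (f x) (f y) ≤ K * dist (g x) (g y)) :
    AbsolutelyContinuousOnInterval f a b := by
  have hK : Tendsto (fun E : ℕ × (ℕ → ℝ × ℝ) =>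
      K * ∑ i ∈ Finset.range E.1, dist (g (E.2 i).1) (g (E.2 i).2))
      (totalLengthFilter ⊓ 𝓟 (disjWithin a b)) (𝓝 0) := by
    simpa using Tendsto.const_mul K hg
  refine squeeze_zero' (Eventually.of_forall fun E => Finset.sum_nonneg fun _ _ => dist_nonneg) ?_
    hK
  refine Eventually.filter_mono inf_le_right (eventually_principal.2 fun E hE => ?_)
  rw [Finset.mul_sum]
  exact Finset.sum_le_sum fun i hi => h _ (hE.1 i hi).1 _ (hE.1 i hi).2

namespace Friedrichs

/-- `F` is absolutely continuous on `[a, b]`, with integrable derivative `f` a.e. on `(a, b)`. -/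
structure IsPrimitive (a b : ℝ) (F f : ℝ → ℂ) : Prop where
  ac : AbsolutelyContinuousOnInterval F a b
  hasDerivAt : ∀ᵐ x ∂volume.restrict (Ioo a b), HasDerivAt F (f x) x
  integrable : Integrable f (volume.restrict (Ioo a b))

/-! ### Absolutely continuous primitives and their relation to weak derivatives. -/

section Primitive

variable {a b : ℝ} {F G f g : ℝ → ℂ}

theorem intervalIntegrable_of_restrict_Ioo {E : Type*} [NormedAddCommGroup E] {f : ℝ → E}
    (hab : a < b) (hf : Integrable f (volume.restrict (Ioo a b))) :
    IntervalIntegrable f volume a b :=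
  (intervalIntegrable_iff_integrableOn_Ioo_of_le hab.le).2 hf

theorem intervalIntegral_eq_integral_Ioo {E : Type*} [NormedAddCommGroup E] [NormedSpace ℝ E]
    (hab : a < b) (f : ℝ → E) : ∫ x in a..b, f x = ∫ x in Ioo a b, f x := by
  rw [intervalIntegral.integral_of_le hab.le, integral_Ioc_eq_integral_Ioo]

theorem isPrimitive_integral (hab : a < b) (c : ℂ)
    (hf : Integrable f (volume.restrict (Ioo a b))) :
    IsPrimitive a b (fun x => c + ∫ t in a..x, f t) f where
  ac := by
    have hi := intervalIntegrable_of_restrict_Ioo hab hf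
    -- The increments of the complex integral are dominated by those of the real integral of `‖f‖`.
    have hN := hi.norm.absolutelyContinuousOnInterval_intervalIntegral (c := a) left_mem_uIcc
    refine hN.of_dist_le (K := 1) fun x hx y hy => ?_
    have hix : IntervalIntegrable f volume a x := hi.mono_set (uIcc_subset_uIcc_left hx)
    have hiy : IntervalIntegrable f volume a y := hi.mono_set (uIcc_subset_uIcc_left hy)
    rw [one_mul, dist_eq_norm, dist_eq_norm, add_sub_add_left_eq_sub,
      intervalIntegral.integral_interval_sub_left hix hiy,
      intervalIntegral.integral_interval_sub_left hix.norm hiy.norm]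
    exact intervalIntegral.norm_integral_le_abs_integral_norm
  hasDerivAt := by
    rw [ae_restrict_iff' measurableSet_Ioo]
    filter_upwards [(intervalIntegrable_of_restrict_Ioo hab hf).ae_hasDerivAt_integral]
      with x hx hx'
    rw [uIcc_of_le hab.le] at hx
    exact (hx (Ioo_subset_Icc_self hx') a ⟨le_rfl, hab.le⟩).const_add c
  integrable := hf

namespace IsPrimitive

theorem continuousOn (h : IsPrimitive a b F f) (hab : a < b) : ContinuousOn F (Icc a b) :=
  uIcc_of_le hab.le ▸ h.ac.continuousOn

theorem sub (h : IsPrimitive a b F f) (k : IsPrimitive a b G g) :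
    IsPrimitive a b (F - G) (f - g) where
  ac := h.ac.sub k.ac
  hasDerivAt := by
    filter_upwards [h.hasDerivAt, k.hasDerivAt] with x h1 h2 using h1.sub h2
  integrable := h.integrable.sub k.integrable

theorem add (h : IsPrimitive a b F f) (k : IsPrimitive a b G g) :
    IsPrimitive a b (F + G) (f + g) where
  ac := h.ac.add k.ac
  hasDerivAt := by
    filter_upwards [h.hasDerivAt, k.hasDerivAt] with x h1 h2 using h1.add h2
  integrable := h.integrable.add k.integrable

theorem const_smul (c : ℂ) (h : IsPrimitive a b F f) : IsPrimitive a b (c • F) (c • f) where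
  ac := h.ac.const_smul c
  hasDerivAt := by
    filter_upwards [h.hasDerivAt] with x h1 using h1.const_smul c
  integrable := h.integrable.smul c

theorem congr_left (h : IsPrimitive a b F f) (hab : a < b) (e : EqOn F G (Icc a b)) :
    IsPrimitive a b G f where
  ac := h.ac.of_dist_le (K := 1) fun x hx y hy => by
    rw [uIcc_of_le hab.le] at hx hy
    rw [e hx, e hy, one_mul]
  hasDerivAt := by
    filter_upwards [h.hasDerivAt, ae_restrict_mem measurableSet_Ioo] with x h1 hx
    exact h1.congr_of_eventuallyEq <| (eventually_of_mem (Icc_mem_nhds hx.1 hx.2) e).mono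
      fun _ h => h.symm
  integrable := h.integrable

theorem congr_right (h : IsPrimitive a b F f) (e : f =ᵐ[volume.restrict (Ioo a b)] g) :
    IsPrimitive a b F g where
  ac := h.ac
  hasDerivAt := by
    filter_upwards [h.hasDerivAt, e] with x h1 hx using hx ▸ h1
  integrable := h.integrable.congr e

/-- The fundamental theorem of calculus. -/
theorem integral_eq (h : IsPrimitive a b F f) (hab : a < b) :
    ∫ x in Ioo a b, f x = F b - F a := by
  -- The difference with the indefinite integral is absolutely continuous with derivative zero
  -- almost everywhere, hence constant.
  have k := h.sub (isPrimitive_integral hab 0 h.integrable)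
  obtain ⟨C, hC⟩ := k.ac.const_of_ae_hasDerivAt_zero <| by
    have := (ae_restrict_iff' measurableSet_Ioo).1 k.hasDerivAt
    have h₁ : ∀ᵐ x, x ≠ a := by simp [ae_iff, measure_singleton]
    have h₂ : ∀ᵐ x, x ≠ b := by simp [ae_iff, measure_singleton]
    filter_upwards [this, h₁, h₂] with x hx ha hb hx'
    rw [uIcc_of_le hab.le] at hx'
    simpa using hx ⟨lt_of_le_of_ne hx'.1 ha.symm, lt_of_le_of_ne hx'.2 hb⟩
  have h1 := hC a left_mem_uIcc
  have h2 := hC b right_mem_uIcc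
  simp only [Pi.sub_apply, zero_add, intervalIntegral.integral_same, sub_zero] at h1 h2
  rw [← intervalIntegral_eq_integral_Ioo hab, h1, ← h2]
  ring

theorem aestronglyMeasurable (h : IsPrimitive a b F f) (hab : a < b) :
    AEStronglyMeasurable F (volume.restrict (Ioo a b)) :=
  ((h.continuousOn hab).mono Ioo_subset_Icc_self).aestronglyMeasurable measurableSet_Ioo

theorem exists_bound (h : IsPrimitive a b F f) (hab : a < b) :
    ∃ C, ∀ᵐ x ∂volume.restrict (Ioo a b), ‖F x‖ ≤ C := by
  obtain ⟨C, hC⟩ := h.ac.exists_bound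
  rw [uIcc_of_le hab.le] at hC
  exact ⟨C, (ae_restrict_mem measurableSet_Ioo).mono fun x hx => hC x (Ioo_subset_Icc_self hx)⟩

theorem mul (h : IsPrimitive a b F f) (k : IsPrimitive a b G g) (hab : a < b) :
    IsPrimitive a b (F * G) (f * G + F * g) where
  ac := h.ac.smul k.ac
  hasDerivAt := by
    filter_upwards [h.hasDerivAt, k.hasDerivAt] with x h1 h2 using h1.mul h2
  integrable := by
    obtain ⟨C, hC⟩ := h.exists_bound hab
    obtain ⟨D, hD⟩ := k.exists_bound hab
    exact (h.integrable.mul_bdd (k.aestronglyMeasurable hab) hD).add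
      (k.integrable.bdd_mul (h.aestronglyMeasurable hab) hC)

theorem conj (h : IsPrimitive a b F f) :
    IsPrimitive a b (fun x => starRingEnd ℂ (F x)) fun x => starRingEnd ℂ (f x) where
  ac := h.ac.of_dist_le (K := 1) fun x _ y _ => by
    rw [one_mul]
    exact (Complex.isometry_conj.dist_eq _ _).le
  hasDerivAt := by
    filter_upwards [h.hasDerivAt] with x h1
    exact (Complex.conjCLE.toContinuousLinearMap.hasFDerivAt (x := F x)).comp_hasDerivAt x h1
  integrable := by
    exact Complex.conjCLE.toContinuousLinearMap.integrable_comp h.integrable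

/-- The derivative vanishes a.e. on the zero set. -/
theorem eq_zero_of_zero (h : IsPrimitive a b F f) :
    ∀ᵐ x ∂volume.restrict (Ioo a b), F x = 0 → f x = 0 := by
  -- Zeros isolated from the right are countably many, hence negligible. At any other zero the
  -- derivative is determined by the values on the zero set, where `F` is constant.
  have hc := (countable_setOfPred_isolated_right_within (s := {x | F x = 0})).ae_notMem
    (volume.restrict (Ioo a b))
  filter_upwards [h.hasDerivAt, hc] with x hx hxc h0
  have hne : 𝓝[{x | F x = 0} ∩ Ioi x] x ≠ ⊥ := fun e => hxc ⟨h0, e⟩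
  have hu : UniqueDiffWithinAt ℝ ({x | F x = 0} ∩ Ioi x) x := by
    rw [uniqueDiffWithinAt_iff_accPt, accPt_principal_iff_nhdsWithin, sdiff_singleton_eq_self
      fun hx => lt_irrefl x hx.2]
    exact ⟨hne⟩
  refine hu.eq_deriv _ hx.hasDerivWithinAt ?_
  exact (hasDerivWithinAt_const x _ (0 : ℂ)).congr (fun y hy => hy.1) h0

end IsPrimitive

theorem IsTest.isPrimitive (h : IsTest a b f) : IsPrimitive a b f (_root_.deriv f) where
  ac := (h.contDiff.of_le (by simp)).contDiffOn.absolutelyContinuousOnInterval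
  hasDerivAt := Eventually.of_forall fun x =>
    (h.contDiff.differentiable (by simp) x).hasDerivAt
  integrable := (h.deriv.contDiff.continuous.integrable_of_hasCompactSupport
    h.deriv.hasCompactSupport).restrict

theorem IsTest.eq_zero (h : IsTest a b f) {x : ℝ} (hx : x ∉ Ioo a b) : f x = 0 :=
  image_eq_zero_of_notMem_tsupport fun h' => hx (h.tsupport_subset h')

theorem IsPrimitive.isWeakDeriv (h : IsPrimitive a b F f) (hab : a < b) : IsWeakDeriv a b F f where
  left := (((h.continuousOn hab).integrableOn_Icc).mono_set Ioo_subset_Icc_self).locallyIntegrableOn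
  right := IntegrableOn.locallyIntegrableOn h.integrable
  integral_eq ψ hψ := by
    have k := h.mul hψ.isPrimitive hab
    have e := k.integral_eq hab
    have i1 := integrableOn_mul_test (IntegrableOn.locallyIntegrableOn h.integrable) hψ
    have i2 := integrableOn_mul_test ((((h.continuousOn hab).integrableOn_Icc).mono_set
      Ioo_subset_Icc_self).locallyIntegrableOn) hψ.deriv
    simp only [Pi.add_apply, Pi.mul_apply, hψ.eq_zero (x := a) (by simp),
      hψ.eq_zero (x := b) (by simp), mul_zero, sub_zero] at e
    rw [integral_add i1 i2] at e
    linear_combination e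

/-- A test function with vanishing integral is the derivative of a test function. -/
theorem IsTest.exists_deriv_eq (h : IsTest a b f) (h0 : ∫ x, f x = 0) :
    ∃ F, IsTest a b F ∧ _root_.deriv F = f := by
  have hd : ∀ x, HasDerivAt (fun x => ∫ t in a..x, f t) (f x) x := fun x =>
    intervalIntegral.integral_hasDerivAt_right
      (h.contDiff.continuous.intervalIntegrable _ _)
      (h.contDiff.continuous.stronglyMeasurableAtFilter _ _) h.contDiff.continuous.continuousAt
  have hd' : _root_.deriv (fun x => ∫ t in a..x, f t) = f := funext fun x => (hd x).deriv
  -- The primitive vanishes left of `p`, where nothing has been integrated, and right of `q`, where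
  -- the whole vanishing integral has. For empty support `sInf` and `sSup` are default values, so
  -- `p`, `q` are chosen by hand.
  obtain ⟨p, q, hpq, hp, hq⟩ : ∃ p q, tsupport f ⊆ Icc p q ∧ a < p ∧ q < b := by
    have hc : IsCompact (tsupport f) := h.hasCompactSupport
    rcases (tsupport f).eq_empty_or_nonempty with h0 | h0
    · exact ⟨a + 1, b - 1, by simp [h0], by simp, by simp⟩
    · exact ⟨_, _, fun x hx => ⟨csInf_le hc.bddBelow hx, le_csSup hc.bddAbove hx⟩,
        (h.tsupport_subset (hc.sInf_mem h0)).1, (h.tsupport_subset (hc.sSup_mem h0)).2⟩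
  have hpqab : Icc p q ⊆ Ioo a b := fun x hx => ⟨hp.trans_le hx.1, hx.2.trans_lt hq⟩
  have hsupp : Function.support (fun x => ∫ t in a..x, f t) ⊆ Icc p q := by
    intro x hx
    by_contra hxK
    refine hx ?_
    rcases lt_or_ge q x with hqx | hxq
    · change ∫ t in a..x, f t = 0
      rw [intervalIntegral.integral_eq_integral_of_support_subset, h0]
      intro t ht
      have := hpq (subset_tsupport f ht)
      exact ⟨hp.trans_le this.1, (this.2.trans_lt hqx).le⟩
    · have hxp : x < p := not_le.1 fun h' => hxK ⟨h', hxq⟩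
      refine intervalIntegral.integral_zero_ae (Eventually.of_forall fun t ht => ?_)
      by_contra hft
      have htp := (hpq (subset_tsupport f hft)).1
      rw [uIoc, mem_Ioc] at ht
      exact absurd (ht.2.trans_lt (max_lt hp hxp)) (not_lt.2 htp)
  have hts : tsupport (fun x => ∫ t in a..x, f t) ⊆ Icc p q :=
    closure_minimal hsupp isClosed_Icc
  refine ⟨fun x => ∫ t in a..x, f t, ⟨?_, ?_, hts.trans hpqab⟩, hd'⟩
  · rw [contDiff_infty_iff_deriv, hd']
    exact ⟨fun x => (hd x).differentiableAt, h.contDiff⟩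
  · exact isCompact_Icc.of_isClosed_subset (isClosed_tsupport _) hts

theorem IsTest.ofReal {ψ : ℝ → ℝ} (h1 : ContDiff ℝ ∞ ψ) (h2 : HasCompactSupport ψ)
    (h3 : tsupport ψ ⊆ Ioo a b) : IsTest a b fun x => (ψ x : ℂ) where
  contDiff := Complex.ofRealCLM.contDiff.comp h1
  hasCompactSupport := h2.comp_left (g := Complex.ofReal) rfl
  tsupport_subset := (closure_mono fun x hx => by simpa using hx).trans h3

/-- If all integrals against test functions vanish, then the function vanishes a.e. -/
theorem ae_eq_zero_of_forall_isTest (hf : LocallyIntegrableOn f (Ioo a b) volume)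
    (h : ∀ ψ, IsTest a b ψ → ∫ x in Ioo a b, f x * ψ x = 0) :
    f =ᵐ[volume.restrict (Ioo a b)] 0 := by
  refine (ae_restrict_iff' measurableSet_Ioo).2 ?_
  refine isOpen_Ioo.ae_eq_zero_of_integral_contDiff_smul_eq_zero hf fun ψ h1 h2 h3 => ?_
  rw [← setIntegral_eq_integral_of_forall_compl_eq_zero (s := Ioo a b),
    ← h _ (IsTest.ofReal h1 h2 h3)]
  · refine integral_congr_ae (Eventually.of_forall fun x => ?_)
    simp [mul_comm]
  · intro x hx
    have : ψ x = 0 := by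
      by_contra hne
      exact hx (h3 (subset_tsupport _ hne))
    simp [this]

theorem exists_isTest_integral_eq_one (hab : a < b) : ∃ ψ, IsTest a b ψ ∧ ∫ x, ψ x = 1 := by
  obtain ⟨ψ, h1, h2, h3, h4, h5⟩ := exists_contDiff_tsupport_subset (n := ⊤)
    (Ioo_mem_nhds (left_lt_add_div_two.2 hab) (add_div_two_lt_right.2 hab))
  have ht := IsTest.ofReal h3 h2 h1
  have hpos : 0 < ∫ x, ψ x := by
    refine h3.continuous.integral_pos_of_hasCompactSupport_nonneg_nonzero h2
      (fun x => (h4 ⟨x, rfl⟩).1) (x := (a + b) / 2) ?_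
    rw [h5]
    exact one_ne_zero
  refine ⟨_, ht.smul ((∫ x, ψ x : ℝ) : ℂ)⁻¹, ?_⟩
  simp only [Pi.smul_apply, smul_eq_mul]
  rw [integral_const_mul, integral_complex_ofReal]
  exact inv_mul_cancel₀ (Complex.ofReal_ne_zero.2 hpos.ne')

theorem IsTest.integral_eq_setIntegral (h : IsTest a b f) :
    ∫ x in Ioo a b, f x = ∫ x, f x :=
  setIntegral_eq_integral_of_forall_compl_eq_zero fun _ hx => h.eq_zero hx

/-- A function with vanishing weak derivative is constant. -/
theorem IsWeakDeriv.exists_const (hab : a < b) (h : IsWeakDeriv a b F 0) :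
    ∃ c : ℂ, F =ᵐ[volume.restrict (Ioo a b)] fun _ => c := by
  obtain ⟨ψ₀, hψ₀, h1⟩ := exists_isTest_integral_eq_one hab
  set c := ∫ x in Ioo a b, F x * ψ₀ x with hc
  have hconst : LocallyIntegrableOn (fun _ : ℝ => c) (Ioo a b) volume :=
    (locallyIntegrable_const c).locallyIntegrableOn _
  refine ⟨c, ?_⟩
  have := ae_eq_zero_of_forall_isTest (h.left.sub hconst) fun ψ hψ => ?_
  · filter_upwards [this] with x hx
    exact sub_eq_zero.1 hx
  -- Subtracting `(∫ ψ) ψ₀` makes the integral zero, so the result is the derivative of a test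
  -- function and is annihilated by `F`; this reads `∫ F ψ = c ∫ ψ`.
  · have hθ : IsTest a b (ψ + (-∫ x, ψ x) • ψ₀) := hψ.add (hψ₀.smul _)
    obtain ⟨Θ, hΘ, hd⟩ := hθ.exists_deriv_eq (by
      simp only [Pi.add_apply, Pi.smul_apply, smul_eq_mul]
      rw [integral_add
        (hψ.contDiff.continuous.integrable_of_hasCompactSupport hψ.hasCompactSupport)
        ((hψ₀.contDiff.continuous.integrable_of_hasCompactSupport
          hψ₀.hasCompactSupport).const_mul _), integral_const_mul, h1]
      ring)
    have e := h.integral_eq Θ hΘ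
    rw [hd] at e
    simp only [Pi.add_apply, Pi.zero_apply, zero_mul, integral_zero, neg_zero, mul_add] at e
    rw [integral_add (integrableOn_mul_test h.left hψ)
      (integrableOn_mul_test h.left (hψ₀.smul _))] at e
    simp only [Pi.smul_apply, smul_eq_mul, mul_left_comm (F _), integral_const_mul] at e
    simp only [Pi.sub_apply, sub_mul]
    rw [integral_sub (integrableOn_mul_test h.left hψ) (integrableOn_mul_test hconst hψ),
      integral_const_mul, hψ.integral_eq_setIntegral]
    linear_combination e

/-- `F` minus the indefinite integral of `f` has zero weak derivative, hence is constant. -/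
theorem IsWeakDeriv.exists_isPrimitive (hab : a < b) (h : IsWeakDeriv a b F f)
    (hf : Integrable f (volume.restrict (Ioo a b))) :
    ∃ G, IsPrimitive a b G f ∧ F =ᵐ[volume.restrict (Ioo a b)] G := by
  have k := (isPrimitive_integral hab 0 hf).isWeakDeriv hab
  have h0 := h.add (k.smul (-1))
  have e : f + (-1 : ℂ) • f = 0 := by simp
  rw [e] at h0
  obtain ⟨c, hc⟩ := h0.exists_const hab
  refine ⟨_, isPrimitive_integral hab c hf, ?_⟩
  filter_upwards [hc] with x hx
  simp only [Pi.add_apply, Pi.smul_apply, smul_eq_mul] at hx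
  linear_combination hx

theorem ae_eq_imp_eqOn (hab : a < b) (hF : ContinuousOn F (Icc a b)) (hG : ContinuousOn G (Icc a b))
    (h : F =ᵐ[volume.restrict (Ioo a b)] G) : EqOn F G (Icc a b) :=
  Measure.eqOn_Icc_of_ae_eq volume hab.ne
    (by rwa [← restrict_Ioo_eq_restrict_Icc]) hF hG

theorem IsW1Infty.isPrimitive (hab : a < b) {α α' : ℝ → ℝ} (h : IsW1Infty a b α α') :
    IsPrimitive a b (fun x => (α x : ℂ)) fun x => (α' x : ℂ) := by
  have hi : Integrable (fun x => (α' x : ℂ)) (volume.restrict (Ioo a b)) :=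
    (h.memLp_deriv.integrable le_top).ofReal
  obtain ⟨G, hG, e⟩ := h.isWeakDeriv.exists_isPrimitive hab hi
  refine hG.congr_left hab fun x hx => (ae_eq_imp_eqOn hab ?_ (hG.continuousOn hab) e hx).symm
  exact Complex.continuous_ofReal.comp_continuousOn h.continuousOn

end Primitive

/-! ### Green's formula through a regularisation of `1/α`. -/

section Green

theorem hasDerivAt_div_sq_add {ε : ℝ} (hε : 0 < ε) (t : ℝ) :
    HasDerivAt (fun t : ℝ => t / (t ^ 2 + ε)) ((ε - t ^ 2) / (t ^ 2 + ε) ^ 2) t := by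
  have h := (hasDerivAt_id t).div ((hasDerivAt_pow 2 t).add_const ε)
    (by positivity : t ^ 2 + ε ≠ 0)
  refine h.congr_deriv ?_
  simp only [id_eq, Nat.cast_ofNat]
  ring

theorem abs_sub_sq_div_le {ε : ℝ} (hε : 0 < ε) (t : ℝ) :
    |(ε - t ^ 2) / (t ^ 2 + ε) ^ 2| ≤ ε⁻¹ := by
  have h : 0 < t ^ 2 + ε := by positivity
  have h1 : |ε - t ^ 2| ≤ t ^ 2 + ε := abs_le.2 ⟨by linarith, by nlinarith [sq_nonneg t]⟩
  rw [abs_div, abs_of_pos (pow_pos h 2), div_le_iff₀ (pow_pos h 2)]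
  calc |ε - t ^ 2| ≤ t ^ 2 + ε := h1
    _ = ε⁻¹ * (ε * (t ^ 2 + ε)) := by field_simp
    _ ≤ ε⁻¹ * (t ^ 2 + ε) ^ 2 := by
      gcongr
      nlinarith [sq_nonneg t]

/-- The Lipschitz bound makes `α/(α² + ε)` absolutely continuous along with `α`. -/
theorem dist_div_sq_add_le {ε : ℝ} (hε : 0 < ε) (s t : ℝ) :
    dist (s / (s ^ 2 + ε)) (t / (t ^ 2 + ε)) ≤ ε⁻¹ * dist s t := by
  rw [dist_eq_norm, dist_eq_norm]
  exact Convex.norm_image_sub_le_of_norm_hasDerivWithin_le (s := univ)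
    (fun x _ => (hasDerivAt_div_sq_add hε x).hasDerivWithinAt)
    (fun x _ => abs_sub_sq_div_le hε x) convex_univ (mem_univ t) (mem_univ s)

variable {a b : ℝ} {α α' : ℝ → ℝ}

/-- A regularisation of `1 / α`. -/
theorem IsPrimitive.div_sq_add (hab : a < b)
    (hα : IsPrimitive a b (fun x => (α x : ℂ)) fun x => (α' x : ℂ)) {ε : ℝ} (hε : 0 < ε) :
    IsPrimitive a b (fun x => ((α x / (α x ^ 2 + ε) : ℝ) : ℂ))
      fun x => (((ε - α x ^ 2) / (α x ^ 2 + ε) ^ 2 : ℝ) : ℂ) * α' x where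
  ac := hα.ac.of_dist_le (K := ε⁻¹) fun x _ y _ => by
    rw [Complex.isometry_ofReal.dist_eq, Complex.isometry_ofReal.dist_eq]
    exact dist_div_sq_add_le hε _ _
  hasDerivAt := by
    filter_upwards [hα.hasDerivAt] with x hx
    have h1 : HasDerivAt α (α' x) x := by
      simpa [Function.comp_def] using
        (Complex.reCLM.hasFDerivAt (x := (α x : ℂ))).comp_hasDerivAt x hx
    have h2 := (Complex.ofRealCLM.hasFDerivAt (x := α x / (α x ^ 2 + ε))).comp_hasDerivAt x
      ((hasDerivAt_div_sq_add hε (α x)).comp x h1)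
    refine h2.congr_deriv ?_
    simp
  integrable := by
    have hc : ContinuousOn α (Icc a b) :=
      Complex.continuous_re.comp_continuousOn (hα.continuousOn hab)
    have hm : AEStronglyMeasurable (fun x => (((ε - α x ^ 2) / (α x ^ 2 + ε) ^ 2 : ℝ) : ℂ))
        (volume.restrict (Ioo a b)) := by
      refine ContinuousOn.aestronglyMeasurable ?_ measurableSet_Ioo
      refine Complex.continuous_ofReal.comp_continuousOn ?_
      have hc' := hc.mono Ioo_subset_Icc_self
      exact (continuousOn_const.sub (hc'.pow 2)).div (((hc'.pow 2).add continuousOn_const).pow 2)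
        fun x _ => by positivity
    refine hα.integrable.bdd_mul hm (c := ε⁻¹) (Eventually.of_forall fun x => ?_)
    rw [Complex.norm_real]
    exact abs_sub_sq_div_le hε _

/-- At `t = 0` all terms vanish, in agreement with `0⁻¹ = 0`; this is what deletes the boundary term
at an endpoint where `α` vanishes. -/
theorem tendsto_div_sq_add {ε : ℕ → ℝ} (hε : Tendsto ε atTop (𝓝 0)) (t : ℝ) :
    Tendsto (fun n => ((t / (t ^ 2 + ε n) : ℝ) : ℂ)) atTop (𝓝 (t : ℂ)⁻¹) := by
  rw [← Complex.ofReal_inv]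
  refine (Complex.continuous_ofReal.tendsto _).comp ?_
  by_cases ht : t = 0
  · simp [ht]
  · have h1 : Tendsto (fun n => t ^ 2 + ε n) atTop (𝓝 (t ^ 2)) := by simpa using hε.const_add (t ^ 2)
    have h2 := (tendsto_const_nhds (x := t)).div h1 (pow_ne_zero 2 ht)
    rwa [show t / t ^ 2 = t⁻¹ by field_simp] at h2

/-- Integration by parts for the quasi-derivatives `w = α u`, `z = α v`. -/
theorem integral_green (hab : a < b)
    (hα : IsPrimitive a b (fun x => (α x : ℂ)) fun x => (α' x : ℂ))
    {u v w w' z z' : ℝ → ℂ} (hw : IsPrimitive a b w w') (hz : IsPrimitive a b z z')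
    (hu : w =ᵐ[volume.restrict (Ioo a b)] fun x => α x * u x)
    (hv : z =ᵐ[volume.restrict (Ioo a b)] fun x => α x * v x)
    (h1 : Integrable (fun x => w' x * starRingEnd ℂ (v x)) (volume.restrict (Ioo a b)))
    (h2 : Integrable (fun x => u x * starRingEnd ℂ (z' x)) (volume.restrict (Ioo a b)))
    (h3 : Integrable (fun x => α' x * (u x * starRingEnd ℂ (v x))) (volume.restrict (Ioo a b))) :
    ∫ x in Ioo a b, (w' x * starRingEnd ℂ (v x) + u x * starRingEnd ℂ (z' x) -
        α' x * (u x * starRingEnd ℂ (v x))) =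
      w b * starRingEnd ℂ (z b) * (α b : ℂ)⁻¹ - w a * starRingEnd ℂ (z a) * (α a : ℂ)⁻¹ := by
  let ε : ℕ → ℝ := fun n => 1 / ((n : ℝ) + 1)
  have hε : ∀ n, 0 < ε n := fun n => Nat.one_div_pos_of_nat
  have hε0 : Tendsto ε atTop (𝓝 0) := tendsto_one_div_add_atTop_nhds_zero_nat
  -- The fundamental theorem is applied to `w conj z α/(α² + ε)`, and `ε` tends to zero on both
  -- sides.
  have hP := fun n => (hw.mul hz.conj hab).mul (hα.div_sq_add hab (hε n)) hab
  refine tendsto_nhds_unique (f := fun n => ∫ x in Ioo a b, (_ : ℝ → ℂ) x)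
    (tendsto_integral_of_dominated_convergence
      (fun x => ‖w' x * starRingEnd ℂ (v x)‖ + ‖u x * starRingEnd ℂ (z' x)‖ +
        ‖α' x * (u x * starRingEnd ℂ (v x))‖) (fun n => (hP n).integrable.aestronglyMeasurable)
      ((h1.norm.add h2.norm).add h3.norm) (fun n => ?_) ?_)
    ((((tendsto_div_sq_add hε0 (α b)).const_mul (w b * starRingEnd ℂ (z b))).sub
      ((tendsto_div_sq_add hε0 (α a)).const_mul (w a * starRingEnd ℂ (z a)))).congr fun n =>
        ((hP n).integral_eq hab).symm)
  · filter_upwards [hu, hv] with x hux hvx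
    have hpos : 0 < α x ^ 2 + ε n := by have := hε n; positivity
    -- The factors `α` in `w = α u` and `z = α v` compensate the singularity: the regularised
    -- integrand is the three given integrable terms multiplied by `c`, `c` and `d`, all of modulus
    -- at most one.
    set c : ℝ := α x ^ 2 / (α x ^ 2 + ε n) with hc
    set d : ℝ := α x ^ 2 * (ε n - α x ^ 2) / (α x ^ 2 + ε n) ^ 2 with hd
    have hc1 : |c| ≤ 1 := by
      rw [hc, abs_of_nonneg (by positivity), div_le_one hpos]
      linarith [hε n]
    have hd1 : |d| ≤ 1 := by
      rw [hd, abs_div, abs_of_pos (pow_pos hpos 2), div_le_one (pow_pos hpos 2), abs_mul,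
        abs_of_nonneg (sq_nonneg _), sq (α x ^ 2 + ε n)]
      refine mul_le_mul (by linarith [hε n]) ?_ (abs_nonneg _) hpos.le
      exact abs_le.2 ⟨by linarith [hε n], by linarith [sq_nonneg (α x)]⟩
    have key : ((w' * (fun x => starRingEnd ℂ (z x)) + w * fun x => starRingEnd ℂ (z' x)) *
          (fun x => ((α x / (α x ^ 2 + ε n) : ℝ) : ℂ)) + (w * fun x => starRingEnd ℂ (z x)) *
          fun x => (((ε n - α x ^ 2) / (α x ^ 2 + ε n) ^ 2 : ℝ) : ℂ) * α' x) x =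
        c * (w' x * starRingEnd ℂ (v x)) + c * (u x * starRingEnd ℂ (z' x)) +
          d * (α' x * (u x * starRingEnd ℂ (v x))) := by
      simp only [Pi.add_apply, Pi.mul_apply, hux, hvx, map_mul, Complex.conj_ofReal, hc, hd]
      push_cast
      ring
    rw [key]
    refine (norm_add₃_le).trans ?_
    have aux : ∀ (r : ℝ) (y : ℂ), |r| ≤ 1 → ‖(r : ℂ) * y‖ ≤ ‖y‖ := fun r y hr => by
      rw [norm_mul, Complex.norm_real]
      exact mul_le_of_le_one_left (norm_nonneg y) hr
    exact add_le_add (add_le_add (aux _ _ hc1) (aux _ _ hc1)) (aux _ _ hd1)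
  · filter_upwards [hu, hv, hα.eq_zero_of_zero, hw.eq_zero_of_zero, hz.eq_zero_of_zero]
      with x hux hvx hαx hwx hzx
    -- On the zero set of `α` the derivatives `α'`, `w'`, `z'` vanish almost everywhere, so both the
    -- integrands and their limit are zero there.
    by_cases h0 : α x = 0
    · have e1 : w x = 0 := by rw [hux, h0, Complex.ofReal_zero, zero_mul]
      have e2 : z x = 0 := by rw [hvx, h0, Complex.ofReal_zero, zero_mul]
      have e3 : (α' x : ℂ) = 0 := hαx (by rw [h0, Complex.ofReal_zero])
      simp [e1, e2, e3, hwx e1, hzx e2]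
    · have t1 := tendsto_div_sq_add hε0 (α x)
      have t2 : Tendsto (fun n => (((ε n - α x ^ 2) / (α x ^ 2 + ε n) ^ 2 : ℝ) : ℂ)) atTop
          (𝓝 (((0 - α x ^ 2) / (α x ^ 2 + 0) ^ 2 : ℝ) : ℂ)) := by
        refine (Complex.continuous_ofReal.tendsto _).comp ?_
        exact (hε0.sub_const _).div ((hε0.const_add _).pow 2) (by simpa using h0)
      have t3 := (t1.const_mul (w' x * starRingEnd ℂ (z x) + w x * starRingEnd ℂ (z' x))).add
        ((t2.mul_const (α' x : ℂ)).const_mul (w x * starRingEnd ℂ (z x)))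
      have h0' : (α x : ℂ) ≠ 0 := Complex.ofReal_ne_zero.2 h0
      have e : w' x * starRingEnd ℂ (v x) + u x * starRingEnd ℂ (z' x) -
          α' x * (u x * starRingEnd ℂ (v x)) =
          (w' x * starRingEnd ℂ (z x) + w x * starRingEnd ℂ (z' x)) * (α x : ℂ)⁻¹ +
            w x * starRingEnd ℂ (z x) *
              ((((0 - α x ^ 2) / (α x ^ 2 + 0) ^ 2 : ℝ) : ℂ) * α' x) := by
        rw [hux, hvx]
        simp only [map_mul, Complex.conj_ofReal]
        push_cast
        rw [zero_sub, add_zero]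
        field_simp
        ring
      rw [e]
      exact t3

end Green

/-! ### Graphs and adjoints of first-order operators in terms of weak derivatives. -/

section Operators

variable {a b : ℝ}

theorem IsWeakDeriv.congr {f g f' g' : ℝ → ℂ} (h : IsWeakDeriv a b f g)
    (hf : f =ᵐ[volume.restrict (Ioo a b)] f') (hg : g =ᵐ[volume.restrict (Ioo a b)] g') :
    IsWeakDeriv a b f' g' where
  left := h.left.congr hf
  right := h.right.congr hg
  integral_eq ψ hψ := by
    have e1 : ∫ x in Ioo a b, f' x * deriv ψ x = ∫ x in Ioo a b, f x * deriv ψ x :=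
      integral_congr_ae (by filter_upwards [hf] with x hx; rw [hx])
    have e2 : ∫ x in Ioo a b, g' x * ψ x = ∫ x in Ioo a b, g x * ψ x :=
      integral_congr_ae (by filter_upwards [hg] with x hx; rw [hx])
    rw [e1, e2, h.integral_eq ψ hψ]

theorem IsWeakDeriv.unique {f g g' : ℝ → ℂ} (h : IsWeakDeriv a b f g) (h' : IsWeakDeriv a b f g') :
    g =ᵐ[volume.restrict (Ioo a b)] g' := by
  have := ae_eq_zero_of_forall_isTest (h.right.sub h'.right) fun ψ hψ => by
    simp only [Pi.sub_apply, sub_mul]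
    rw [integral_sub (integrableOn_mul_test h.right hψ) (integrableOn_mul_test h'.right hψ)]
    linear_combination h.integral_eq ψ hψ - h'.integral_eq ψ hψ
  filter_upwards [this] with x hx
  exact sub_eq_zero.1 hx

theorem IsTest.conj {φ : ℝ → ℂ} (h : IsTest a b φ) : IsTest a b fun x => starRingEnd ℂ (φ x) where
  contDiff := Complex.conjCLE.contDiff.comp h.contDiff
  hasCompactSupport := h.hasCompactSupport.comp_left (g := starRingEnd ℂ) (map_zero _)
  tsupport_subset := (closure_mono fun x hx => by simpa using hx).trans h.tsupport_subset

theorem IsTest.deriv_conj {φ : ℝ → ℂ} (h : IsTest a b φ) (x : ℝ) :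
    _root_.deriv (fun x => starRingEnd ℂ (φ x)) x = starRingEnd ℂ (_root_.deriv φ x) :=
  ((Complex.conjCLE.toContinuousLinearMap.hasFDerivAt (x := φ x)).comp_hasDerivAt x
    (h.contDiff.differentiable (by simp) x).hasDerivAt).deriv

theorem IsTest.memLp_top {φ : ℝ → ℂ} (h : IsTest a b φ) :
    MemLp φ ∞ (volume.restrict (Ioo a b)) := by
  obtain ⟨C, hC⟩ := h.contDiff.continuous.bounded_above_of_compact_support h.hasCompactSupport
  exact memLp_top_of_bound h.contDiff.continuous.aestronglyMeasurable C (Eventually.of_forall hC)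

theorem memLp_two_of_top {f : ℝ → ℂ} (h : MemLp f ∞ (volume.restrict (Ioo a b))) :
    MemLp f 2 (volume.restrict (Ioo a b)) := h.mono_exponent le_top

theorem memLp_top_mul {f g : ℝ → ℂ} (hf : MemLp f ∞ (volume.restrict (Ioo a b)))
    (hg : MemLp g ∞ (volume.restrict (Ioo a b))) :
    MemLp (f * g) ∞ (volume.restrict (Ioo a b)) := hg.mul hf

theorem memLp_top_mul_two {f g : ℝ → ℂ} (hf : MemLp f ∞ (volume.restrict (Ioo a b)))
    (hg : MemLp g 2 (volume.restrict (Ioo a b))) :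
    MemLp (f * g) 2 (volume.restrict (Ioo a b)) := hg.mul hf

theorem inner_L2 (u v : L2 a b) :
    inner ℂ u v = ∫ x in Ioo a b, v x * starRingEnd ℂ (u x) := by
  rw [L2.inner_def]
  rfl

theorem integrable_mul_conj {u v : ℝ → ℂ} (hu : MemLp u 2 (volume.restrict (Ioo a b)))
    (hv : MemLp v 2 (volume.restrict (Ioo a b))) :
    Integrable (fun x => u x * starRingEnd ℂ (v x)) (volume.restrict (Ioo a b)) :=
  hu.integrable_mul (hv.star)

theorem IsPrimitive.memLp_top (hab : a < b) {F f : ℝ → ℂ} (h : IsPrimitive a b F f) :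
    MemLp F ∞ (volume.restrict (Ioo a b)) := by
  obtain ⟨C, hC⟩ := h.exists_bound hab
  exact memLp_top_of_bound (h.aestronglyMeasurable hab) C hC

theorem locallyIntegrableOn_of_memLp {f : ℝ → ℂ} (h : MemLp f 2 (volume.restrict (Ioo a b))) :
    LocallyIntegrableOn f (Ioo a b) volume :=
  IntegrableOn.locallyIntegrableOn (h.integrable one_le_two)

variable {p p' : ℝ → ℝ} {q : ℝ → ℂ}

theorem mem_op_graph (hab : a < b)
    (hp : IsPrimitive a b (fun x => (p x : ℂ)) fun x => (p' x : ℂ)) {x y : L2 a b} :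
    (x, y) ∈ (op a b (fun x => (p x : ℂ)) q).graph ↔ ∃ φ, IsTest a b φ ∧
      x =ᵐ[volume.restrict (Ioo a b)] φ ∧ y =ᵐ[volume.restrict (Ioo a b)]
        fun t => p' t * φ t + p t * deriv φ t + q t * φ t := by
  rw [op, Submodule.toLinearPMap_graph_eq _ (opGraph_functional a b _ q)]
  constructor
  · rintro ⟨φ, g, hφ, hg, hx, hy⟩
    refine ⟨φ, hφ, hx, hy.trans ?_⟩
    filter_upwards [hg.unique ((hp.mul hφ.isPrimitive hab).isWeakDeriv hab)] with t ht
    simp [ht]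
  · rintro ⟨φ, hφ, hx, hy⟩
    refine ⟨φ, _, hφ, (hp.mul hφ.isPrimitive hab).isWeakDeriv hab, hx, hy.trans ?_⟩
    exact Eventually.of_forall fun t => by simp

theorem exists_mem_op_graph (hab : a < b)
    (hp : IsPrimitive a b (fun x => (p x : ℂ)) fun x => (p' x : ℂ))
    (hp' : MemLp p' ∞ (volume.restrict (Ioo a b))) (hq : MemLp q ∞ (volume.restrict (Ioo a b)))
    {φ : ℝ → ℂ} (hφ : IsTest a b φ) :
    ∃ x y : L2 a b, (x, y) ∈ (op a b (fun x => (p x : ℂ)) q).graph ∧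
      x =ᵐ[volume.restrict (Ioo a b)] φ ∧ y =ᵐ[volume.restrict (Ioo a b)]
        fun t => p' t * φ t + p t * deriv φ t + q t * φ t := by
  have h2 : MemLp (fun t => p' t * φ t + p t * deriv φ t + q t * φ t) 2
      (volume.restrict (Ioo a b)) := memLp_two_of_top
    (((memLp_top_mul hp'.ofReal hφ.memLp_top).add
      (memLp_top_mul (hp.memLp_top hab) hφ.deriv.memLp_top)).add (memLp_top_mul hq hφ.memLp_top))
  refine ⟨(memLp_two_of_top hφ.memLp_top).toLp _, h2.toLp _, ?_, MemLp.coeFn_toLp _,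
    MemLp.coeFn_toLp _⟩
  exact (mem_op_graph hab hp).2 ⟨φ, hφ, MemLp.coeFn_toLp _, MemLp.coeFn_toLp _⟩

theorem dense_op_domain (hab : a < b)
    (hp : IsPrimitive a b (fun x => (p x : ℂ)) fun x => (p' x : ℂ))
    (hp' : MemLp p' ∞ (volume.restrict (Ioo a b))) (hq : MemLp q ∞ (volume.restrict (Ioo a b))) :
    Dense ((op a b (fun x => (p x : ℂ)) q).domain : Set (L2 a b)) := by
  rw [Submodule.dense_iff_topologicalClosure_eq_top, Submodule.topologicalClosure_eq_top_iff,
    Submodule.eq_bot_iff]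
  intro f hf
  rw [Submodule.mem_orthogonal] at hf
  refine Lp.ext (EventuallyEq.trans ?_ (Lp.coeFn_zero _ _ _).symm)
  refine ae_eq_zero_of_forall_isTest (locallyIntegrableOn_of_memLp (Lp.memLp f)) fun ψ hψ => ?_
  obtain ⟨x, y, hxy, hx, -⟩ := exists_mem_op_graph hab hp hp' hq hψ.conj
  have := hf x (LinearPMap.mem_domain_of_mem_graph hxy)
  rw [inner_L2] at this
  rw [← this]
  refine integral_congr_ae ?_
  filter_upwards [hx] with t ht
  rw [ht, Complex.conj_conj]

/-- The adjoint of a first order operator acts in the sense of weak derivatives. -/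
theorem mem_op_adjoint_graph (hab : a < b)
    (hp : IsPrimitive a b (fun x => (p x : ℂ)) fun x => (p' x : ℂ))
    (hp' : MemLp p' ∞ (volume.restrict (Ioo a b))) (hq : MemLp q ∞ (volume.restrict (Ioo a b)))
    {u f : L2 a b} :
    (u, f) ∈ ((op a b (fun x => (p x : ℂ)) q)†).graph ↔
      IsWeakDeriv a b (fun t => p t * u t)
        fun t => p' t * u t + starRingEnd ℂ (q t) * u t - f t := by
  have hpu : MemLp (fun t => p t * u t) 2 (volume.restrict (Ioo a b)) :=
    memLp_top_mul_two (hp.memLp_top hab) (Lp.memLp u)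
  have hr : MemLp (fun t => p' t * u t + starRingEnd ℂ (q t) * u t - f t) 2
      (volume.restrict (Ioo a b)) :=
    ((memLp_top_mul_two hp'.ofReal (Lp.memLp u)).add
      (memLp_top_mul_two hq.star (Lp.memLp u))).sub (Lp.memLp f)
  have hl := locallyIntegrableOn_of_memLp hpu
  have hl' := locallyIntegrableOn_of_memLp hr
  -- The defect in the adjoint relation against a graph element equals the defect in the weak
  -- derivative identity, tested with `conj φ`.
  have key : ∀ (x y : L2 a b) (φ : ℝ → ℂ), IsTest a b φ →
      x =ᵐ[volume.restrict (Ioo a b)] φ →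
      (y =ᵐ[volume.restrict (Ioo a b)] fun t => p' t * φ t + p t * deriv φ t + q t * φ t) →
      inner ℂ y u - inner ℂ x f =
        (∫ t in Ioo a b, p t * u t * deriv (fun t => starRingEnd ℂ (φ t)) t) +
          ∫ t in Ioo a b, (p' t * u t + starRingEnd ℂ (q t) * u t - f t) *
            starRingEnd ℂ (φ t) := by
    intro x y φ hφ hx hy
    rw [inner_L2, inner_L2, ← integral_sub (integrable_mul_conj (Lp.memLp u) (Lp.memLp y))
      (integrable_mul_conj (Lp.memLp f) (Lp.memLp x)),
      ← integral_add (integrableOn_mul_test hl hφ.conj.deriv) (integrableOn_mul_test hl' hφ.conj)]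
    refine integral_congr_ae ?_
    filter_upwards [hx, hy] with t h1 h2
    rw [h1, h2, hφ.deriv_conj]
    simp only [map_add, map_mul, Complex.conj_ofReal]
    ring
  rw [LinearPMap.adjoint_graph_eq_graph_adjoint (dense_op_domain hab hp hp' hq),
    Submodule.mem_adjoint_iff]
  constructor
  · intro h
    refine ⟨hl, hl', fun ψ hψ => ?_⟩
    obtain ⟨x, y, hxy, hx, hy⟩ := exists_mem_op_graph hab hp hp' hq hψ.conj
    have := key x y _ hψ.conj hx hy
    rw [h x y hxy] at this
    simp only [Complex.conj_conj] at this
    linear_combination -this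
  · intro h x y hxy
    obtain ⟨φ, hφ, hx, hy⟩ := (mem_op_graph hab hp).1 hxy
    rw [key x y φ hφ hx hy, h.integral_eq _ hφ.conj, neg_add_cancel]

end Operators

/-! ### The two maximal operators for the given coefficients. -/

section Coefficients

variable {a b : ℝ} {α α' : ℝ → ℝ} {β : ℝ → ℂ}

theorem mem_opT_adjoint_graph (hab : a < b) (hα : IsW1Infty a b α α')
    (hβ : MemLp β ∞ (volume.restrict (Ioo a b))) {u f : L2 a b} :
    (u, f) ∈ ((opT a b α β)†).graph ↔ IsWeakDeriv a b (fun t => α t * u t)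
      fun t => α' t * u t + starRingEnd ℂ (β t) * u t - f t :=
  mem_op_adjoint_graph hab (hα.isPrimitive hab) hα.memLp_deriv hβ

theorem isPrimitive_neg (hab : a < b) (hα : IsW1Infty a b α α') :
    IsPrimitive a b (fun x => ((-α x : ℝ) : ℂ)) fun x => ((-α' x : ℝ) : ℂ) := by
  have h := (hα.isPrimitive hab).const_smul (-1)
  have e1 : ((-1 : ℂ) • fun x => (α x : ℂ)) = fun x => ((-α x : ℝ) : ℂ) := by
    funext x
    simp
  have e2 : ((-1 : ℂ) • fun x => (α' x : ℂ)) = fun x => ((-α' x : ℝ) : ℂ) := by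
    funext x
    simp
  rwa [e1, e2] at h

theorem memLp_coeff_adj (hα : IsW1Infty a b α α')
    (hβ : MemLp β ∞ (volume.restrict (Ioo a b))) :
    MemLp (fun x => starRingEnd ℂ (β x) + (α' x : ℂ)) ∞ (volume.restrict (Ioo a b)) :=
  hβ.star.add hα.memLp_deriv.ofReal

theorem opTt_eq : opTt a b α α' β =
    op a b (fun x => ((-α x : ℝ) : ℂ)) fun x => starRingEnd ℂ (β x) + (α' x : ℂ) := by
  rw [opTt]
  congr 1
  funext x
  simp

/-- With `p = -α` and `q = conj β + α'` the terms in `α'` cancel, and a change of sign leaves `(α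
u)' = f - β u`. -/
theorem mem_opTt_adjoint_graph (hab : a < b) (hα : IsW1Infty a b α α')
    (hβ : MemLp β ∞ (volume.restrict (Ioo a b))) {u f : L2 a b} :
    (u, f) ∈ ((opTt a b α α' β)†).graph ↔ IsWeakDeriv a b (fun t => α t * u t)
      fun t => f t - β t * u t := by
  rw [opTt_eq, mem_op_adjoint_graph hab (isPrimitive_neg hab hα) hα.memLp_deriv.neg
    (memLp_coeff_adj hα hβ)]
  constructor
  · intro h
    refine (h.smul (-1)).congr (Eventually.of_forall fun t => ?_) (Eventually.of_forall fun t => ?_)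
    · simp
    · simp
      ring
  · intro h
    refine (h.smul (-1)).congr (Eventually.of_forall fun t => ?_) (Eventually.of_forall fun t => ?_)
    · simp
    · simp
      ring

end Coefficients

/-! ### Endpoint values of almost everywhere defined functions. -/

section Values

variable {a b : ℝ}

/-- Two continuous functions that agree a.e. near a point of `[a, b]` agree at that point. -/
theorem HasValueAt.unique (hab : a < b) {u : ℝ → ℂ} {x : ℝ} (hx : x ∈ Icc a b) {z z' : ℂ}
    (h : HasValueAt a b u x z) (h' : HasValueAt a b u x z') : z = z' := by
  obtain ⟨f, U, hU, hf, huf, rfl⟩ := h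
  obtain ⟨g, V, hV, hg, hug, rfl⟩ := h'
  -- The two representatives agree on `S`, which has full measure in `(a, b)` near `x` and thus
  -- accumulates at `x`; their limits along `S` are the two values.
  set S := {t | t ∈ U ∩ V ∩ Ioo a b ∧ f t = g t} with hS
  have hae : ∀ᵐ t ∂volume.restrict (Ioo a b), t ∈ U ∩ V → f t = g t := by
    filter_upwards [huf, hug] with t h1 h2 ht
    rw [← h1 ht.1, h2 ht.2]
  have hne : (𝓝[S] x).NeBot := by
    rw [← mem_closure_iff_nhdsWithin_neBot, mem_closure_iff_nhds]
    intro O hO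
    have hN : interior (O ∩ (U ∩ V)) ∈ 𝓝 x :=
      interior_mem_nhds.2 (inter_mem hO (inter_mem hU hV))
    have hxc : x ∈ closure (Ioo a b) := by rwa [closure_Ioo hab.ne]
    have hne := mem_closure_iff_nhds.1 hxc _ hN
    have hpos := (isOpen_interior.inter isOpen_Ioo).measure_pos volume hne
    by_contra hemp
    rw [not_nonempty_iff_eq_empty] at hemp
    refine hpos.ne' (measure_mono_null (fun t ht => ?_)
      (ae_iff.1 ((ae_restrict_iff' measurableSet_Ioo).1 hae)))
    intro hcon
    have ht' := interior_subset ht.1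
    have : t ∈ O ∩ S := ⟨ht'.1, ⟨⟨ht'.2, ht.2⟩, hcon ht.2 ht'.2⟩⟩
    rw [hemp] at this
    exact this
  have hfx : Tendsto f (𝓝[S] x) (𝓝 (f x)) :=
    (hf x ⟨mem_of_mem_nhds hU, hx⟩).mono fun t ht => ⟨ht.1.1.1, Ioo_subset_Icc_self ht.1.2⟩
  have hgx : Tendsto g (𝓝[S] x) (𝓝 (g x)) :=
    (hg x ⟨mem_of_mem_nhds hV, hx⟩).mono fun t ht => ⟨ht.1.1.2, Ioo_subset_Icc_self ht.1.2⟩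
  exact tendsto_nhds_unique_of_eventuallyEq hfx hgx
    (eventually_of_mem self_mem_nhdsWithin fun t ht => ht.2)

theorem HasValueAt.valueAt_eq (hab : a < b) {u : ℝ → ℂ} {x : ℝ} (hx : x ∈ Icc a b) {z : ℂ}
    (h : HasValueAt a b u x z) : valueAt a b u x = z := by
  have hex : ∃ z, HasValueAt a b u x z := ⟨z, h⟩
  rw [valueAt, dif_pos hex]
  exact hex.choose_spec.unique hab hx h

/-- Where `α` is nonzero the continuous representative of `α u` can be divided by `α` nearby. -/
theorem hasValueAt_of_continuousOn_mul {α : ℝ → ℝ} {u w : ℝ → ℂ} {x : ℝ} (hx : x ∈ Icc a b)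
    (hα : ContinuousOn α (Icc a b)) (hw : ContinuousOn w (Icc a b))
    (h : (fun t => α t * u t) =ᵐ[volume.restrict (Ioo a b)] w) (h0 : α x ≠ 0) :
    HasValueAt a b u x ((α x : ℂ)⁻¹ * w x) := by
  have hn : {t | α t ≠ 0} ∈ 𝓝[Icc a b] x := (hα x hx).eventually_ne h0
  obtain ⟨U, hU, hxU, hsub⟩ := mem_nhdsWithin.1 hn
  refine ⟨fun t => (α t : ℂ)⁻¹ * w t, U, hU.mem_nhds hxU, ?_, ?_, rfl⟩
  · refine ContinuousOn.mul (ContinuousOn.inv₀ ?_ fun t ht => ?_) (hw.mono inter_subset_right)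
    · exact Complex.continuous_ofReal.comp_continuousOn (hα.mono inter_subset_right)
    · exact Complex.ofReal_ne_zero.2 (hsub ht)
  · filter_upwards [h, ae_restrict_mem measurableSet_Ioo] with t ht ht' htU
    have : (α t : ℂ) ≠ 0 := Complex.ofReal_ne_zero.2 (hsub ⟨htU, Ioo_subset_Icc_self ht'⟩)
    rw [← ht]
    field_simp

end Values

/-! ### Trace functionals and the boundary system of the differential operators. -/

section Traces

variable {a b : ℝ} {α α' : ℝ → ℝ} {β : ℝ → ℂ}

theorem isPrimitive_affine (a b : ℝ) (c d : ℂ) :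
    IsPrimitive a b (fun x => c + d * x) fun _ => d := by
  have hd : ∀ x : ℝ, HasDerivAt (fun x : ℝ => c + d * (x : ℂ)) d x := fun x => by
    simpa using ((Complex.ofRealCLM.hasDerivAt (x := x)).const_mul d).const_add c
  refine ⟨ContDiffOn.absolutelyContinuousOnInterval ?_, Eventually.of_forall hd,
    integrable_const _⟩
  have : ContDiff ℝ 1 fun x : ℝ => c + d * (x : ℂ) :=
    contDiff_const.add (contDiff_const.mul Complex.ofRealCLM.contDiff)
  exact this.contDiffOn

/-- The endpoint values of the continuous representatives of the functions `α u`, as linear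
functionals. -/
theorem exists_traces (hab : a < b) {W : Submodule ℂ (L2 a b)}
    (hW : ∀ u ∈ W, ∃ w w', IsPrimitive a b w w' ∧
      (fun t => α t * u t) =ᵐ[volume.restrict (Ioo a b)] w) :
    ∃ ta tb : W →ₗ[ℂ] ℂ, ∀ (u : W) (w w' : ℝ → ℂ), IsPrimitive a b w w' →
      ((fun t => α t * (u : L2 a b) t) =ᵐ[volume.restrict (Ioo a b)] w) →
      ta u = w a ∧ tb u = w b := by
  choose w w' hw hwu using fun u : W => hW u u.2
  -- Uniqueness of the continuous representative makes the chosen one additive and homogeneous in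
  -- `u`.
  have huniq : ∀ (u : W) (z z' : ℝ → ℂ), IsPrimitive a b z z' →
      ((fun t => α t * (u : L2 a b) t) =ᵐ[volume.restrict (Ioo a b)] z) →
      EqOn (w u) z (Icc a b) := fun u z z' hz h =>
    ae_eq_imp_eqOn hab ((hw u).continuousOn hab) (hz.continuousOn hab) ((hwu u).symm.trans h)
  have hadd : ∀ u v, EqOn (w (u + v)) (w u + w v) (Icc a b) := fun u v => by
    refine huniq _ _ _ ((hw u).add (hw v)) ?_
    filter_upwards [hwu u, hwu v, Lp.coeFn_add (u : L2 a b) (v : L2 a b)] with t h1 h2 h3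
    rw [Submodule.coe_add, h3, Pi.add_apply, Pi.add_apply, ← h1, ← h2, mul_add]
  have hsmul : ∀ (c : ℂ) u, EqOn (w (c • u)) (c • w u) (Icc a b) := fun c u => by
    refine huniq _ _ _ ((hw u).const_smul c) ?_
    filter_upwards [hwu u, Lp.coeFn_smul c (u : L2 a b)] with t h1 h3
    rw [Submodule.coe_smul, h3, Pi.smul_apply, Pi.smul_apply, ← h1, smul_eq_mul, smul_eq_mul,
      mul_left_comm]
  have ha : a ∈ Icc a b := left_mem_Icc.2 hab.le
  have hb : b ∈ Icc a b := right_mem_Icc.2 hab.le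
  exact ⟨⟨⟨fun u => w u a, fun u v => hadd u v ha⟩, fun c u => hsmul c u ha⟩,
    ⟨⟨fun u => w u b, fun u v => hadd u v hb⟩, fun c u => hsmul c u hb⟩,
    fun u z z' hz h => ⟨huniq u z z' hz h ha, huniq u z z' hz h hb⟩⟩

theorem exists_toFun_of_domain_eq {H : Type*} [NormedAddCommGroup H] [InnerProductSpace ℂ H]
    {A : H →ₗ.[ℂ] H} {W : Submodule ℂ H} (h : W = A.domain) : ∃ L : W →ₗ[ℂ] H, A = ⟨W, L⟩ := by
  subst h
  exact ⟨A.toFun, rfl⟩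

theorem re_inner_L2 (u v : L2 a b) :
    (inner ℂ u v).re = ∫ x in Ioo a b, (v x * starRingEnd ℂ (u x)).re := by
  rw [inner_L2]
  exact (integral_re (integrable_mul_conj (Lp.memLp v) (Lp.memLp u))).symm

/-- The one-dimensional operators form a boundary system whose boundary functionals are the
endpoint values. -/
theorem exists_boundarySystem (hab : a < b) (hα : IsW1Infty a b α α')
    (hβ : MemLp β ∞ (volume.restrict (Ioo a b))) {μ₀ : ℝ} (hμ₀ : 0 < μ₀)
    (hpos : ∀ᵐ x ∂volume.restrict (Ioo a b), 2 * μ₀ ≤ 2 * (β x).re + α' x)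
    {W : Submodule ℂ (L2 a b)} (hW : W = ((opTt a b α α' β)†).domain) :
    ∃ (L Lt : W →ₗ[ℂ] L2 a b) (va vb : W →ₗ[ℂ] ℂ),
      BoundarySystem (opT a b α β) (opTt a b α α' β) W L Lt μ₀ (α a) (α b) va vb ∧
      (∀ u : W, α a ≠ 0 → HasValueAt a b (u : L2 a b) a (va u)) ∧
      ∀ u : W, α b ≠ 0 → HasValueAt a b (u : L2 a b) b (vb u) := by
  have hprim := hα.isPrimitive hab
  have hα'c : MemLp (fun x => (α' x : ℂ)) ∞ (volume.restrict (Ioo a b)) := hα.memLp_deriv.ofReal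
  have hdT : Dense ((opT a b α β).domain : Set (L2 a b)) :=
    dense_op_domain hab hprim hα.memLp_deriv hβ
  have hdTt : Dense ((opTt a b α α' β).domain : Set (L2 a b)) := by
    rw [opTt_eq]
    exact dense_op_domain hab (isPrimitive_neg hab hα) hα.memLp_deriv.neg (memLp_coeff_adj hα hβ)
  -- The sum of the two maximal operators is multiplication by the bounded function `2 Re β + α'`;
  -- hence `f ↦ m - f` turns a solution of one weak equation into one of the other, and the two
  -- maximal domains coincide.
  have hM : ∀ u : L2 a b, ∃ m : L2 a b, m =ᵐ[volume.restrict (Ioo a b)]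
      fun t => (β t + starRingEnd ℂ (β t) + α' t) * u t := fun u =>
    ⟨_, MemLp.coeFn_toLp (memLp_top_mul_two ((hβ.add hβ.star).add hα'c) (Lp.memLp u))⟩
  have hdom : W = ((opT a b α β)†).domain := by
    rw [hW]
    ext u
    rw [LinearPMap.mem_domain_iff, LinearPMap.mem_domain_iff]
    simp_rw [mem_opT_adjoint_graph hab hα hβ, mem_opTt_adjoint_graph hab hα hβ]
    obtain ⟨m, hm⟩ := hM u
    constructor <;> rintro ⟨f, hf⟩ <;>
      refine ⟨m - f, hf.congr (ae_eq_refl _) ?_⟩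
    · filter_upwards [hm, Lp.coeFn_sub m f] with t h1 h2
      rw [h2, Pi.sub_apply, h1]
      ring
    · filter_upwards [hm, Lp.coeFn_sub m f] with t h1 h2
      rw [h2, Pi.sub_apply, h1]
      ring
  obtain ⟨L, hL⟩ := exists_toFun_of_domain_eq hW
  obtain ⟨Lt, hLt⟩ := exists_toFun_of_domain_eq hdom
  have hgL : ∀ u : W, IsWeakDeriv a b (fun t => α t * (u : L2 a b) t)
      fun t => L u t - β t * (u : L2 a b) t := fun u => by
    rw [← mem_opTt_adjoint_graph hab hα hβ, hL]
    exact LinearPMap.mem_graph ⟨W, L⟩ u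
  have hgLt : ∀ u : W, IsWeakDeriv a b (fun t => α t * (u : L2 a b) t)
      fun t => α' t * (u : L2 a b) t + starRingEnd ℂ (β t) * (u : L2 a b) t - Lt u t := fun u => by
    rw [← mem_opT_adjoint_graph hab hα hβ, hLt]
    exact LinearPMap.mem_graph ⟨W, Lt⟩ u
  have hmemW : ∀ u f : L2 a b, IsWeakDeriv a b (fun t => α t * u t) (fun t => f t - β t * u t) →
      u ∈ W := fun u f h =>
    hW ▸ LinearPMap.mem_domain_of_mem_graph ((mem_opTt_adjoint_graph hab hα hβ).2 h)
  have hrep : ∀ u : W, ∃ w, IsPrimitive a b w (fun t => L u t - β t * (u : L2 a b) t) ∧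
      (fun t => α t * (u : L2 a b) t) =ᵐ[volume.restrict (Ioo a b)] w := fun u =>
    (hgL u).exists_isPrimitive hab
      (((Lp.memLp (L u)).sub (memLp_top_mul_two hβ (Lp.memLp (u : L2 a b)))).integrable one_le_two)
  obtain ⟨ta, tb, ht⟩ := exists_traces (α := α) hab (W := W) fun u hu => by
    obtain ⟨w, h1, h2⟩ := hrep ⟨u, hu⟩
    exact ⟨w, _, h1, h2⟩
  have hsum : ∀ u : W, ∀ᵐ t ∂volume.restrict (Ioo a b), L u t + Lt u t =
      (β t + starRingEnd ℂ (β t) + α' t) * (u : L2 a b) t := fun u => by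
    filter_upwards [(hgL u).unique (hgLt u)] with t h
    linear_combination h
  -- Dividing the traces of `α u` by `α` gives `u(a)` and `u(b)`; where `α` vanishes at an endpoint,
  -- the functional is zero by `0⁻¹ = 0`.
  refine ⟨L, Lt, (α a : ℂ)⁻¹ • ta, (α b : ℂ)⁻¹ • tb,
    ⟨⟨hdT, hdTt, ?_, hL, hLt⟩, hμ₀, fun u => ?_, fun u v => ?_, fun za zb => ?_⟩, fun u h0 => ?_,
    fun u h0 => ?_⟩
  · have h1 : opT a b α β ≤ (opTt a b α α' β)† := by
      refine LinearPMap.le_of_le_graph ?_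
      rintro ⟨x, y⟩ hxy
      rw [mem_opTt_adjoint_graph hab hα hβ]
      obtain ⟨φ, hφ, hx, hy⟩ := (mem_op_graph hab hprim).1 hxy
      refine ((hprim.mul hφ.isPrimitive hab).isWeakDeriv hab).congr ?_ ?_
      · filter_upwards [hx] with t h
        rw [h, Pi.mul_apply]
      · filter_upwards [hx, hy] with t h h'
        rw [h, h', Pi.add_apply, Pi.mul_apply, Pi.mul_apply]
        ring
    intro x y
    have h2 := LinearPMap.adjoint_isFormalAdjoint hdTt ⟨x, h1.1 x.2⟩ y
    rwa [← h1.2 (x := x) (y := ⟨x, h1.1 x.2⟩) rfl] at h2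
  · have hu2 := Lp.memLp (u : L2 a b)
    have hi := integrable_mul_conj hu2 hu2
    rw [← inner_self_eq_norm_sq (𝕜 := ℂ) (u : L2 a b)]
    change 2 * μ₀ * (inner ℂ (u : L2 a b) (u : L2 a b)).re ≤ _
    rw [re_inner_L2, re_inner_L2, ← integral_const_mul]
    refine integral_mono_ae (hi.re.const_mul _)
      (integrable_mul_conj (Lp.memLp (L u + Lt u)) hu2).re ?_
    filter_upwards [hpos, hsum u, Lp.coeFn_add (L u) (Lt u)] with t h1 h2 h3
    have h4 : ((β t + starRingEnd ℂ (β t) + α' t) : ℂ) = ((2 * (β t).re + α' t : ℝ) : ℂ) := by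
      rw [Complex.add_conj]
      push_cast
      ring
    rw [h3, Pi.add_apply, h2, h4, mul_assoc ((_ : ℝ) : ℂ), Complex.re_ofReal_mul, Complex.mul_conj,
      Complex.ofReal_re]
    exact mul_le_mul_of_nonneg_right h1 (Complex.normSq_nonneg _)
  · obtain ⟨w, hw, hwu⟩ := hrep u
    obtain ⟨z, hz, hzv⟩ := hrep v
    -- Writing `(α v)'` through `Lt v` and `(α u)'` through `L u`, all terms with `β` and `α'`
    -- cancel in Green's integrand, leaving `L u conj v - u conj (Lt v)`.
    have hz' := hz.congr_right ((hgL v).unique (hgLt v))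
    have hLu := Lp.memLp (L u)
    have hu2 := Lp.memLp (u : L2 a b)
    have hv2 := Lp.memLp (v : L2 a b)
    have e := integral_green hab hprim hw hz' hwu.symm hzv.symm
      (integrable_mul_conj (hLu.sub (memLp_top_mul_two hβ hu2)) hv2)
      (integrable_mul_conj hu2 (((memLp_top_mul_two hα'c hv2).add
        (memLp_top_mul_two hβ.star hv2)).sub (Lp.memLp (Lt v))))
      ((integrable_mul_conj (memLp_top_mul_two hα'c hu2) hv2).congr
        (Eventually.of_forall fun t => by simp only [Pi.mul_apply, mul_assoc]))
    rw [bform, inner_L2, inner_L2, ← integral_sub (integrable_mul_conj hLu hv2)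
      (integrable_mul_conj hu2 (Lp.memLp (Lt v)))]
    obtain ⟨h1, h2⟩ := ht u w _ hw hwu
    obtain ⟨h3, h4⟩ := ht v z _ hz hzv
    simp only [LinearMap.smul_apply, smul_eq_mul, h1, h2, h3, h4, map_mul, map_inv₀,
      Complex.conj_ofReal]
    have inv_aux : ∀ x y r : ℂ, r * (r⁻¹ * x) * (r⁻¹ * y) = x * y * r⁻¹ := fun x y r => by
      by_cases hr : r = 0
      · simp [hr]
      · field_simp
    rw [inv_aux, inv_aux, ← e]
    refine integral_congr_ae (Eventually.of_forall fun t => ?_)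
    simp only [map_sub, map_add, map_mul, Complex.conj_ofReal, Complex.conj_conj]
    ring
  · have hne : ((b - a : ℝ) : ℂ) ≠ 0 := Complex.ofReal_ne_zero.2 (sub_pos.2 hab).ne'
    -- The affine function from `za` at `a` to `zb` at `b` lies in `W` and has the prescribed
    -- endpoint values.
    set d : ℂ := (zb - za) / ((b - a : ℝ) : ℂ) with hd
    have haff := isPrimitive_affine a b (za - d * a) d
    have hmul := hprim.mul haff hab
    have hx2 := memLp_two_of_top (haff.memLp_top hab)
    set x : L2 a b := hx2.toLp _ with hxdef
    have hx : x =ᵐ[volume.restrict (Ioo a b)] fun t => za - d * a + d * t := MemLp.coeFn_toLp hx2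
    have hf2 := memLp_two_of_top (((memLp_top_mul hα'c (haff.memLp_top hab)).add
      (memLp_top_mul (hprim.memLp_top hab) (memLp_top_const d))).add
        (memLp_top_mul hβ (haff.memLp_top hab)))
    have hxw : (fun t => α t * x t) =ᵐ[volume.restrict (Ioo a b)]
        (fun t : ℝ => (α t : ℂ)) * fun t : ℝ => za - d * a + d * (t : ℂ) := by
      filter_upwards [hx] with t h
      rw [h, Pi.mul_apply]
    have hxW : x ∈ W := hmemW x (hf2.toLp _) <| (hmul.isWeakDeriv hab).congr hxw.symm <| by
      filter_upwards [hx, MemLp.coeFn_toLp hf2] with t h1 h2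
      rw [h2, h1]
      simp only [Pi.add_apply, Pi.mul_apply]
      ring
    obtain ⟨h1, h2⟩ := ht ⟨x, hxW⟩ _ _ hmul hxw
    refine ⟨⟨x, hxW⟩, fun h0 => ?_, fun h0 => ?_⟩
    · have h0' : (α a : ℂ) ≠ 0 := Complex.ofReal_ne_zero.2 h0
      rw [LinearMap.smul_apply, h1, smul_eq_mul, Pi.mul_apply, inv_mul_cancel_left₀ h0']
      ring
    · have h0' : (α b : ℂ) ≠ 0 := Complex.ofReal_ne_zero.2 h0
      rw [LinearMap.smul_apply, h2, smul_eq_mul, Pi.mul_apply, inv_mul_cancel_left₀ h0']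
      have : d * ((b - a : ℝ) : ℂ) = zb - za := div_mul_cancel₀ _ hne
      push_cast at this
      linear_combination this
  · obtain ⟨w, hw, hwu⟩ := hrep u
    rw [LinearMap.smul_apply, (ht u w _ hw hwu).1]
    exact hasValueAt_of_continuousOn_mul (left_mem_Icc.2 hab.le) hα.continuousOn
      (hw.continuousOn hab) hwu h0
  · obtain ⟨w, hw, hwu⟩ := hrep u
    rw [LinearMap.smul_apply, (ht u w _ hw hwu).2]
    exact hasValueAt_of_continuousOn_mul (right_mem_Icc.2 hab.le) hα.continuousOn
      (hw.continuousOn hab) hwu h0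

end Traces

/-! ### From endpoint values and pairs `(c, d)` to traces and the complex parameter. -/

section Translation

variable {a b : ℝ} {α : ℝ → ℝ} {W : Submodule ℂ (L2 a b)} {va vb : W →ₗ[ℂ] ℂ}

theorem boundarySpace_eq_lineSpace (hab : a < b)
    (ha : ∀ u : W, HasValueAt a b (u : L2 a b) a (va u))
    (hb : ∀ u : W, HasValueAt a b (u : L2 a b) b (vb u)) (γ δ : ℂ) :
    boundarySpace a b W γ δ = lineSpace va vb γ δ := by
  ext x
  rw [mem_lineSpace]
  constructor
  · rintro ⟨hx, za, zb, h1, h2, h3⟩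
    have e1 := h1.unique hab (left_mem_Icc.2 hab.le) (ha ⟨x, hx⟩)
    have e2 := h2.unique hab (right_mem_Icc.2 hab.le) (hb ⟨x, hx⟩)
    exact ⟨hx, by rw [← e1, ← e2, h3]⟩
  · rintro ⟨hx, h⟩
    exact ⟨hx, _, _, ha ⟨x, hx⟩, hb ⟨x, hx⟩, h⟩

theorem valueAt_left (hab : a < b) (ha : ∀ u : W, HasValueAt a b (u : L2 a b) a (va u)) (u : W) :
    valueAt a b (u : L2 a b) a = va u :=
  (ha u).valueAt_eq hab (left_mem_Icc.2 hab.le)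

theorem valueAt_right (hab : a < b) (hb : ∀ u : W, HasValueAt a b (u : L2 a b) b (vb u)) (u : W) :
    valueAt a b (u : L2 a b) b = vb u :=
  (hb u).valueAt_eq hab (right_mem_Icc.2 hab.le)

theorem domT_eq (hab : a < b) (ha : ∀ u : W, HasValueAt a b (u : L2 a b) a (va u))
    (hb : ∀ u : W, HasValueAt a b (u : L2 a b) b (vb u)) (φ φt : W) (k : ℂ) :
    domT a b α W φ φt k =
      familyDom va vb (α a) (α b) (Real.sqrt (α a / α b)) φ φt k := by
  simp only [domT, familyDom, jump, ratio, valueAt_left hab ha, valueAt_right hab hb]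
  exact boundarySpace_eq_lineSpace hab ha hb _ _

theorem domTadj_eq (hab : a < b) (ha : ∀ u : W, HasValueAt a b (u : L2 a b) a (va u))
    (hb : ∀ u : W, HasValueAt a b (u : L2 a b) b (vb u)) (φ φt : W) (k : ℂ) :
    domTadj a b α W φ φt k =
      familyAdjDom va vb (α a) (α b) (Real.sqrt (α a / α b)) φ φt k := by
  simp only [domTadj, familyAdjDom, jump, ratio, valueAt_left hab ha, valueAt_right hab hb]
  exact boundarySpace_eq_lineSpace hab ha hb _ _

theorem exists_ne_zero_iff {p : ℂ → Prop} :
    (∃ k, k ≠ 0 ∧ p k) ↔ ∃ c d : ℝ, (c, d) ≠ (0, 0) ∧ p (c + d * Complex.I) := by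
  constructor
  · rintro ⟨k, hk, h⟩
    refine ⟨k.re, k.im, fun e => hk ?_, by rwa [Complex.re_add_im]⟩
    exact Complex.ext (congrArg Prod.fst e) (congrArg Prod.snd e)
  · rintro ⟨c, d, hcd, h⟩
    refine ⟨_, fun e => hcd ?_, h⟩
    have h1 := congrArg Complex.re e
    have h2 := congrArg Complex.im e
    simp only [Complex.add_re, Complex.add_im, Complex.ofReal_re, Complex.ofReal_im,
      Complex.re_ofReal_mul, Complex.im_ofReal_mul, Complex.I_re, Complex.I_im, mul_zero, mul_one,
      add_zero, zero_add, Complex.zero_re, Complex.zero_im] at h1 h2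
    rw [h1, h2]

end Translation

end Friedrichs
-- The main theorem.
theorem mainTheorem3 (a b : ℝ) (hab : a < b) (α α' : ℝ → ℝ) (hα : Friedrichs.IsW1Infty a b α α')
    (β : ℝ → ℂ) (hβ : MemLp β ∞ (volume.restrict (Ioo a b)))
    (μ₀ : ℝ) (hμ₀ : 0 < μ₀)
    (hpos : ∀ᵐ x ∂volume.restrict (Ioo a b), 2 * μ₀ ≤ 2 * (β x).re + α' x)
    (T Tt : Friedrichs.L2 a b →ₗ.[ℂ] Friedrichs.L2 a b)
    (hT : T = Friedrichs.opT a b α β) (hTt : Tt = Friedrichs.opTt a b α α' β)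
    (W W₀ : Submodule ℂ (Friedrichs.L2 a b)) (hW : W = Tt†.domain) (hW₀ : W₀ = T.closure.domain) :
    -- endpoints with `α(a) α(b) ≤ 0`
    (α a * α b ≤ 0 →
      ∃! P : Submodule ℂ (Friedrichs.L2 a b) × Submodule ℂ (Friedrichs.L2 a b),
        Friedrichs.IsAdjointBijectivePair T Tt P.1 P.2) ∧
    (0 ≤ α a → α b ≤ 0 →
      (∀ V Vt, Friedrichs.IsAdjointBijectivePair T Tt V Vt ↔ V = W₀ ∧ Vt = W) ∧
      (∀ V, Friedrichs.IsBijectiveRealisation T Tt V ↔ V = W₀)) ∧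
    (α a ≤ 0 → 0 ≤ α b →
      (∀ V Vt, Friedrichs.IsAdjointBijectivePair T Tt V Vt ↔ V = W ∧ Vt = W₀) ∧
      (∀ V, Friedrichs.IsBijectiveRealisation T Tt V ↔ V = W)) ∧
    -- dimensions of the kernels of the maximal operators `T₁ = Tt†` and `T̃₁ = T†`
    (α a = 0 ∧ α b = 0 →
      Module.rank ℂ (Friedrichs.kernel Tt†) = 0 ∧ Module.rank ℂ (Friedrichs.kernel T†) = 0) ∧
    ((0 < α a ∧ α b = 0) ∨ (α a = 0 ∧ α b < 0) →
      Module.rank ℂ (Friedrichs.kernel Tt†) = 1 ∧ Module.rank ℂ (Friedrichs.kernel T†) = 0) ∧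
    ((α a < 0 ∧ α b = 0) ∨ (α a = 0 ∧ 0 < α b) →
      Module.rank ℂ (Friedrichs.kernel Tt†) = 0 ∧ Module.rank ℂ (Friedrichs.kernel T†) = 1) ∧
    (0 < α a ∧ α b < 0 →
      Module.rank ℂ (Friedrichs.kernel Tt†) = 2 ∧ Module.rank ℂ (Friedrichs.kernel T†) = 0) ∧
    (α a < 0 ∧ 0 < α b →
      Module.rank ℂ (Friedrichs.kernel Tt†) = 0 ∧ Module.rank ℂ (Friedrichs.kernel T†) = 2) ∧
    -- endpoints with `α(a) α(b) > 0`
    (0 < α a * α b →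
      Module.rank ℂ (Friedrichs.kernel Tt†) = 1 ∧ Module.rank ℂ (Friedrichs.kernel T†) = 1 ∧
      -- the values `u(a)`, `u(b)` of `u ∈ W` are well defined
      (∀ u ∈ W, (∃! z, Friedrichs.HasValueAt a b u a z) ∧ (∃! z, Friedrichs.HasValueAt a b u b z)) ∧
      {P : Submodule ℂ (Friedrichs.L2 a b) × Submodule ℂ (Friedrichs.L2 a b) |
        Friedrichs.IsAdjointBijectivePair T Tt P.1 P.2}.Infinite ∧
      ∀ φ ∈ Friedrichs.kernel Tt†, φ ≠ 0 → ∀ φt ∈ Friedrichs.kernel T†, φt ≠ 0 →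
        Friedrichs.jump a b α φ ≠ 0 ∧ Friedrichs.jump a b α φt ≠ 0 ∧
        (∀ V Vt, Friedrichs.IsAdjointBijectivePair T Tt V Vt ↔
          (V = Friedrichs.domRef a b α W ∧ Vt = Friedrichs.domRef a b α W) ∨
          ∃ c d : ℝ, (c, d) ≠ (0, 0) ∧ V = Friedrichs.domT a b α W φ φt (c + d * Complex.I) ∧
            Vt = Friedrichs.domTadj a b α W φ φt (c + d * Complex.I)) ∧
        (∀ V, Friedrichs.IsBijectiveRealisation T Tt V ↔
          V = Friedrichs.domRef a b α W ∨
          ∃ c d : ℝ, (c, d) ≠ (0, 0) ∧ V = Friedrichs.domT a b α W φ φt (c + d * Complex.I)) ∧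
        -- the realisations listed are pairwise different
        (∀ c d : ℝ, Friedrichs.domT a b α W φ φt (c + d * Complex.I) ≠
          Friedrichs.domRef a b α W) ∧
        (∀ c d c' d' : ℝ, Friedrichs.domT a b α W φ φt (c + d * Complex.I) =
          Friedrichs.domT a b α W φ φt (c' + d' * Complex.I) → c = c' ∧ d = d')) := by
  obtain ⟨L, Lt, va, vb, h, hva, hvb⟩ :=
    Friedrichs.exists_boundarySystem hab hα hβ hμ₀ hpos (W := W) (by rw [hW, hTt])
  rw [← hT, ← hTt] at h
  have hmin := fun ha hb => h.characterisation_minimal ha hb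
  have hmax := fun ha hb => h.characterisation_maximal ha hb
  rw [← hW₀] at hmin hmax
  refine ⟨fun hab0 => ?_, hmin, hmax, fun ⟨ha, hb⟩ => ?_, fun hs => ?_, fun hs => ?_,
    fun ⟨ha, hb⟩ => ?_, fun ⟨ha, hb⟩ => ?_, fun hp => ?_⟩
  · rcases mul_nonpos_iff.1 hab0 with ⟨ha, hb⟩ | ⟨ha, hb⟩
    · exact ⟨(W₀, W), ((hmin ha hb).1 _ _).2 ⟨rfl, rfl⟩, fun P hP =>
        Prod.ext (((hmin ha hb).1 _ _).1 hP).1 (((hmin ha hb).1 _ _).1 hP).2⟩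
    · exact ⟨(W, W₀), ((hmax ha hb).1 _ _).2 ⟨rfl, rfl⟩, fun P hP =>
        Prod.ext (((hmax ha hb).1 _ _).1 hP).1 (((hmax ha hb).1 _ _).1 hP).2⟩
  · exact ⟨h.rank_kernel_eq_zero ha hb, h.rank_kernel_adj_eq_zero ha.ge hb.le⟩
  · rcases hs with ⟨ha, hb⟩ | ⟨ha, hb⟩
    · exact ⟨h.rank_kernel_eq_one_left ha hb, h.rank_kernel_adj_eq_zero ha.le hb.le⟩
    · exact ⟨h.rank_kernel_eq_one_right ha hb, h.rank_kernel_adj_eq_zero ha.ge hb.le⟩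
  · rcases hs with ⟨ha, hb⟩ | ⟨ha, hb⟩
    · exact ⟨h.swap.rank_kernel_adj_eq_zero (neg_nonneg.2 ha.le) (neg_nonpos.2 hb.ge),
        h.swap.rank_kernel_eq_one_left (neg_pos.2 ha) (neg_eq_zero.2 hb)⟩
    · exact ⟨h.swap.rank_kernel_adj_eq_zero (neg_nonneg.2 ha.le) (neg_nonpos.2 hb.le),
        h.swap.rank_kernel_eq_one_right (neg_eq_zero.2 ha) (neg_neg_iff_pos.2 hb)⟩
  · exact ⟨h.rank_kernel_eq_two ha hb, h.rank_kernel_adj_eq_zero ha.le hb.le⟩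
  · exact ⟨h.swap.rank_kernel_adj_eq_zero (neg_nonneg.2 ha.le) (neg_nonpos.2 hb.le),
      h.swap.rank_kernel_eq_two (neg_pos.2 ha) (neg_neg_iff_pos.2 hb)⟩
  · have ha : α a ≠ 0 := left_ne_zero_of_mul hp.ne'
    have hb : α b ≠ 0 := right_ne_zero_of_mul hp.ne'
    -- The endpoint values of `α` may both be negative; only the positivity of their quotient, equal
    -- to `α(a) α(b) / α(b)²`, is needed for the square root.
    have hs : α b * Real.sqrt (α a / α b) ^ 2 = α a := by
      have hdiv : α a / α b = α a * α b / α b ^ 2 := by field_simp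
      rw [Real.sq_sqrt (by rw [hdiv]; positivity)]
      field_simp
    have hs' : -α b * Real.sqrt (α a / α b) ^ 2 = -α a := by rw [neg_mul, hs]
    have hva := fun u => hva u ha
    have hvb := fun u => hvb u hb
    have hr := h.rank_kernel_eq_one ha hb hs
    have hrt := h.swap.rank_kernel_eq_one (neg_ne_zero.2 ha) (neg_ne_zero.2 hb) hs'
    have href : Friedrichs.domRef a b α W =
        Friedrichs.lineSpace va vb 1 (Real.sqrt (α a / α b) : ℝ) :=
      Friedrichs.boundarySpace_eq_lineSpace hab hva hvb _ _
    refine ⟨hr, hrt, fun u hu => ⟨⟨_, hva ⟨u, hu⟩, fun z hz => ?_⟩, ⟨_, hvb ⟨u, hu⟩, fun z hz => ?_⟩⟩,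
      ?_, fun φ hkφ hφ0 φt hkφt hφt0 => ?_⟩
    · exact hz.unique hab (left_mem_Icc.2 hab.le) (hva ⟨u, hu⟩)
    · exact hz.unique hab (right_mem_Icc.2 hab.le) (hvb ⟨u, hu⟩)
    · have hne : ∀ {K : Submodule ℂ (Friedrichs.L2 a b)}, Module.rank ℂ K = 1 →
          ∃ x ∈ K, x ≠ 0 := fun {K} hK => by
        refine K.ne_bot_iff.1 fun e => ?_
        rw [e, rank_bot] at hK
        exact zero_ne_one hK
      obtain ⟨x, hx, hx0⟩ := hne hr
      obtain ⟨y, hy, hy0⟩ := hne hrt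
      obtain ⟨φ, rfl, hφ⟩ := h.mem_kernel.1 hx
      obtain ⟨φt, rfl, hφt⟩ := h.toMaximalPair.swap.mem_kernel.1 hy
      have hφ0 : φ ≠ 0 := fun e => hx0 (by rw [e]; rfl)
      have hφt0 : φt ≠ 0 := fun e => hy0 (by rw [e]; rfl)
      -- The parameters `k = n + 1` are nonzero, and different parameters give different first
      -- components.
      refine Set.infinite_of_injective_forall_mem (f := fun n : ℕ =>
        (Friedrichs.familyDom va vb (α a) (α b) (Real.sqrt (α a / α b)) φ φt (n + 1),
          Friedrichs.familyAdjDom va vb (α a) (α b) (Real.sqrt (α a / α b)) φ φt (n + 1)))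
        (fun m n hmn => ?_) fun n =>
          h.isAdjointBijectivePair_family ha hb hs hφ hφ0 hφt hφt0 (Nat.cast_add_one_ne_zero n)
      have := h.familyDom_injective ha hb hs hφ hφ0 hφt hφt0 (congrArg Prod.fst hmn)
      exact Nat.cast_injective (add_right_cancel this)
    · obtain ⟨φ, rfl, hφ⟩ := h.mem_kernel.1 hkφ
      obtain ⟨φt, rfl, hφt⟩ := h.toMaximalPair.swap.mem_kernel.1 hkφt
      replace hφ0 : φ ≠ 0 := fun e => hφ0 (by rw [e]; rfl)
      replace hφt0 : φt ≠ 0 := fun e => hφt0 (by rw [e]; rfl)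
      simp only [Friedrichs.domT_eq hab hva hvb, Friedrichs.domTadj_eq hab hva hvb, href]
      refine ⟨?_, ?_, fun V Vt => ?_, fun V => ?_, fun c d => ?_, fun c d c' d' e => ?_⟩
      · rw [Friedrichs.jump, Friedrichs.valueAt_left hab hva, Friedrichs.valueAt_right hab hvb]
        exact h.jump_ne_zero ha hb hs hφ hφ0
      · rw [Friedrichs.jump, Friedrichs.valueAt_left hab hva, Friedrichs.valueAt_right hab hvb]
        exact h.swap.jump_ne_zero (neg_ne_zero.2 ha) (neg_ne_zero.2 hb) hs' hφt hφt0
      · rw [h.isAdjointBijectivePair_iff ha hb hs hφ hφ0 hφt hφt0, Friedrichs.exists_ne_zero_iff]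
      · rw [h.isBijectiveRealisation_iff ha hb hs hφ hφ0 hφt hφt0, Friedrichs.exists_ne_zero_iff]
      · exact h.familyDom_ne_ref ha hb hs hφ hφ0 hφt hφt0 _
      · have hk := h.familyDom_injective ha hb hs hφ hφ0 hφt hφt0 e
        have h1 := congrArg Complex.re hk
        have h2 := congrArg Complex.im hk
        simp only [Complex.add_re, Complex.add_im, Complex.ofReal_re, Complex.ofReal_im,
          Complex.re_ofReal_mul, Complex.im_ofReal_mul, Complex.I_re, Complex.I_im, mul_zero,
          mul_one, add_zero, zero_add] at h1 h2
        exact ⟨h1, h2⟩
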